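/- **Setting.** Let $\mathcal X$ be a standard Borel space and let $\mathcal H_K$ be a separable reproducing kernel Hilbert space of real-valued functions on $\mathcal X$ with kernel $K$, $K_x=K(x,\cdot)$, all of whose elements are measurable and satisfy $\|f\|_\infty\le\kappa\|f\|_{\mathcal H_K}$ for some $\kappa>0$. For a probability measure $\nu$ on $\mathcal X$ and points ${\bf x}=(x_1,\dots,x_k)\in\mathcal X^k$ put $$\bar T=\bar T_\nu=\kappa^{-2}\int_{\mathcal X}\langle\cdot,K_x\rangle K_x\,\nu(dx),\qquad \bar T_{\bf x}=\kappa^{-2}\frac1k\sum_{i=1}^k\langle\cdot,K_{x_i}\rangle K_{x_i}.$$ Let $\mu_1\ge\mu_2\ge\dots$ be the positive eigenvalues of $\bar T_\nu$ counted with multiplicity (with $\mu_j=0$ if there are fewer than $j$). Fix $b>1$, $\beta>0$, $r>0$, $s\in[0,\tfrac12]$ and a real $p\ge1$. Let $\mathcal P^<(b,\beta)$ be the set of probability measures $\nu$ on $\mathcal X$ with $\mu_j\le\beta j^{-b}$ for all $j\ge1$. For $\sigma,M,R>0$ let $\mathcal M_{\sigma,M,R}$ be the set of probability measures $\rho(dx,dy)=\rho(dy|x)\nu(dx)$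 on $\mathcal X\times\mathbb R$ with $\nu\in\mathcal P^<(b,\beta)$ for which there is $f_\rho=\bar T_\nu^r h$ with $h\in\mathcal H_K$, $\|h\|_{\mathcal H_K}\le R$, such that, for $\nu$-almost all $x$, $\mathbb E_\rho[Y|X=x]=f_\rho(x)$ and $\mathbb E_\rho[|Y-f_\rho(X)|^2\,|\,X=x]\le\sigma^2$. (This $f_\rho$ is uniquely determined by $\rho$. Nothing depends on $M$; it is kept as an index only.) Let $g:(0,1]\times[0,1]\to\mathbb R$, $g_\lambda=g(\lambda,\cdot)$ Borel measurable, be a regularization function: there are finite constants $D',E,\gamma_0$ such that $|tg_\lambda(t)|\le D'$, $|g_\lambda(t)|\le E/\lambda$ and $|1-tg_\lambda(t)|\le\gamma_0$ for all $\lambda,t\in(0,1]$. Assume that it has qualification at least $r+s$: for some $q\ge r+s$ and some $\gamma_q>0$, $|1-tg_\lambda(t)|\,t^q\le\gamma_q\lambda^q$ for all $\lambda,t\in(0,1]$. Given a sample $D=((x_i,y_i))_{i=1}^n$ and a partition of the index set into $m$ subsets of equal size $n/m$ (so $m$ divides $n$), with corresponding input vectors ${\bf x}_1,\dots,{\bf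 x}_m$, let $$\tilde f_D^\lambda=\frac1m\sum_{j=1}^m g_\lambda(\bar T_{{\bf x}_j})\bar T_{{\bf x}_j}f_\rho,$$ where functions of operators are understood in the sense of spectral calculus. Put $$\lambda_n=\min\Big\{\Big(\frac{\sigma^2}{R^2n}\Big)^{\frac{b}{2br+b+1}},1\Big\},\qquad a_n=R\Big(\frac{\sigma^2}{R^2n}\Big)^{\frac{b(r+s)}{2br+b+1}}.$$ **Theorem (approximation error).** If $$\alpha<\frac{2b\min\{r,1\}}{2br+b+1},$$ then $$\sup_{(\sigma,M,R)\in(0,\infty)^3}\ \limsup_{n\to\infty}\ \sup_{m\le n^\alpha}\ \sup_{\rho\in\mathcal M_{\sigma,M,R}}\frac{\mathbb E_{\rho^{\otimes n}}\Big[\big\|\bar T^s(f_\rho-\tilde f_D^{\lambda_n})\big\|_{\mathcal H_K}^p\Big]^{1/p}}{a_n}<\infty,$$ where the supremum over $m$ is over all $m\ge1$ with $m\mid n$ and $m\le n^\alpha$, and all partitions of the $n$ indices into $m$ subsets of equal size. -/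

import Mathlib

open MeasureTheory ProbabilityTheory Filter Topology

noncomputable section

namespace DistLearn

/-! ### Spectral calculus for compact self-adjoint operators on a real Hilbert space -/

section Spectral

variable {H : Type*} [NormedAddCommGroup H] [InnerProductSpace ℝ H] [CompleteSpace H]

/-- The eigenspace `ker (A - μ)` of a bounded operator `A`. -/
abbrev eigSpace (A : H →L[ℝ] H) (μ : ℝ) : Submodule ℝ H :=
  Module.End.eigenspace (A : H →ₗ[ℝ] H) μ

instance completeSpace_eigSpace (A : H →L[ℝ] H) (μ : ℝ) : CompleteSpace (eigSpace A μ) := by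
  have h : IsClosed ((eigSpace A μ : Submodule ℝ H) : Set H) := by
    have : ((eigSpace A μ : Submodule ℝ H) : Set H) = {x | A x = μ • x} := by
      ext x
      simp
    rw [this]
    exact isClosed_eq A.continuous (continuous_const_smul μ)
  exact h.completeSpace_coe

/-- The operator `φ(A)` for a compact self-adjoint operator `A` and a function `φ` that is bounded
on the set of eigenvalues: `φ(A) v = ∑_μ φ(μ) P_μ v`, where `P_μ` is the orthogonal projection onto
`ker (A - μ)`. The sum may run over all real `μ` (including `μ = 0`), because `P_μ = 0` when `μ` is
not an eigenvalue. -/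
def specFun (φ : ℝ → ℝ) (A : H →L[ℝ] H) (v : H) : H :=
  ∑' μ : ℝ, φ μ • (eigSpace A μ).starProjection v

/-- The power `A ^ u`, `u ≥ 0`, of a compact positive self-adjoint operator. As `0 ^ 0 = 1`, the
power `A ^ 0` is the identity; for `u > 0` the power vanishes on the kernel of `A`. -/
def opPow (A : H →L[ℝ] H) (u : ℝ) (v : H) : H :=
  specFun (fun t => t ^ u) A v

/-- The `j`-th largest positive eigenvalue (`j = 1, 2, …`), counted with multiplicity, of a compact
positive self-adjoint operator `A`: the largest `t > 0` such that the eigenspaces belonging to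
eigenvalues `≥ t` together have dimension at least `j`. It is `0` if `A` has fewer than `j` positive
eigenvalues. -/
def eigenvalue (A : H →L[ℝ] H) (j : ℕ) : ℝ :=
  sSup {t : ℝ | 0 < t ∧
    (j : Cardinal) ≤ Module.rank ℝ (⨆ μ ∈ Set.Ici t, eigSpace A μ : Submodule ℝ H)}

end Spectral

/-! ### Regularization functions -/

/-- A regularization function `g : (0,1] × [0,1] → ℝ`; values of `g` elsewhere are irrelevant. -/
structure IsRegularization (g : ℝ → ℝ → ℝ) : Prop where
  measurable : ∀ lam ∈ Set.Ioc (0 : ℝ) 1, Measurable (fun t : Set.Icc (0 : ℝ) 1 => g lam t)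
  bound_mul : ∃ D : ℝ, ∀ lam ∈ Set.Ioc (0 : ℝ) 1, ∀ t ∈ Set.Ioc (0 : ℝ) 1, |t * g lam t| ≤ D
  bound : ∃ E : ℝ, ∀ lam ∈ Set.Ioc (0 : ℝ) 1, ∀ t ∈ Set.Ioc (0 : ℝ) 1, |g lam t| ≤ E / lam
  bound_residual : ∃ γ₀ : ℝ, ∀ lam ∈ Set.Ioc (0 : ℝ) 1, ∀ t ∈ Set.Ioc (0 : ℝ) 1,
    |1 - g lam t * t| ≤ γ₀

/-- The estimate defining the qualification holds with exponent `q`. -/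
def HasQualification (g : ℝ → ℝ → ℝ) (q : ℝ) : Prop :=
  ∃ γ : ℝ, 0 < γ ∧ ∀ lam ∈ Set.Ioc (0 : ℝ) 1, ∀ t ∈ Set.Ioc (0 : ℝ) 1,
    |1 - g lam t * t| * t ^ q ≤ γ * lam ^ q

/-! ### Covariance operators and the statistical model

`H` is a reproducing kernel Hilbert space of real functions on `X`. -/

section Model

variable {X : Type*} {H : Type*} [NormedAddCommGroup H] [InnerProductSpace ℝ H]
  [CompleteSpace H] [RKHS ℝ H X ℝ]

variable (H) in
/-- The kernel section `K_x ∈ H`, characterized by `⟪f, K_x⟫ = f x`. -/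
def kerSec (x : X) : H := RKHS.kerFun H x (1 : ℝ)

variable (H) in
/-- `T_x = K_x ⊗ K_x^*`, that is `f ↦ ⟪K_x, f⟫ K_x = f(x) K_x`. -/
def pointOp (x : X) : H →L[ℝ] H := InnerProductSpace.rankOne ℝ (kerSec H x) (kerSec H x)

variable (H) in
/-- The normalized covariance operator `κ⁻² ∫ K_x ⊗ K_x^* dν(x)` (Bochner integral of operators). -/
def covOp [MeasurableSpace X] (κ : ℝ) (ν : Measure X) : H →L[ℝ] H :=
  (κ ^ 2)⁻¹ • ∫ x, pointOp H x ∂ν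

variable (H) in
/-- The normalized empirical covariance operator `κ⁻² |I|⁻¹ ∑_{i ∈ I} K_{x_i} ⊗ K_{x_i}^*` of the
subsample with indices in `I`. -/
def empCovOp {ι : Type*} (κ : ℝ) (x : ι → X) (I : Finset ι) : H →L[ℝ] H :=
  (κ ^ 2)⁻¹ • ((I.card : ℝ)⁻¹ • ∑ i ∈ I, pointOp H (x i))

/-- The subsample with label `j` of the partition of `{0, …, n-1}` given by the labelling `c`. -/
def block {n m : ℕ} (c : Fin n → Fin m) (j : Fin m) : Finset (Fin n) :=
  Finset.univ.filter (fun i => c i = j)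

/-- The labelling `c` splits the `n` indices into `m` subsets, each of size exactly `n / m`. -/
def IsEqualPartition {n m : ℕ} (c : Fin n → Fin m) : Prop :=
  ∀ j : Fin m, m * (block c j).card = n

/-- `f̃_D^λ = m⁻¹ ∑_j g_λ(T̄_{x_j}) T̄_{x_j} f`, where `x_j` is the vector of inputs in the `j`-th
subsample. -/
def avgApprox {n m : ℕ} (κ : ℝ) (g : ℝ → ℝ → ℝ) (lam : ℝ) (c : Fin n → Fin m)
    (x : Fin n → X) (f : H) : H :=
  (m : ℝ)⁻¹ • ∑ j : Fin m,
    specFun (g lam) (empCovOp H κ x (block c j)) (empCovOp H κ x (block c j) f)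

variable [MeasurableSpace X]

variable (H) in
/-- The class `𝒫^<(b, β)` of probability measures whose covariance operator has eigenvalues
`μ_j ≤ β / j ^ b` for all `j ≥ 1`. -/
def priorClass (κ b β : ℝ) : Set (Measure X) :=
  {ν | IsProbabilityMeasure ν ∧
    ∀ j : ℕ, 1 ≤ j → eigenvalue (covOp H κ ν) j ≤ β / (j : ℝ) ^ b}

variable (H) in
/-- The source set `Ω_ν(r, R)`. -/
def sourceSet (κ : ℝ) (ν : Measure X) (r R : ℝ) : Set H :=
  {f | ∃ h : H, ‖h‖ ≤ R ∧ f = opPow (covOp H κ ν) r h}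

/-- `ρ` belongs to the model class `ℳ(r, R, 𝒫^<(b, β))` with noise level `σ`, and `f ∈ Ω_ν(r, R)` is
its regression function: `ρ(dx, dy) = η(dy | x) ν(dx)` where `ν ∈ 𝒫^<(b, β)` is the first marginal,
and `E[Y | X = x] = f x` and `E[|Y - f X|² | X = x] ≤ σ²` for `ν`-almost all `x`.

Elements of `Ω_ν(r, R)` are orthogonal to the kernel of the covariance operator, so `f` is uniquely
determined by `ρ`. -/
def InModel (κ b β r σ R : ℝ) (ρ : Measure (X × ℝ)) (f : H) : Prop :=
  ρ.fst ∈ priorClass H κ b β ∧ f ∈ sourceSet H κ ρ.fst r R ∧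
    ∃ η : Kernel X ℝ, IsMarkovKernel η ∧ ρ = ρ.fst ⊗ₘ η ∧
      ∀ᵐ x ∂ρ.fst, Integrable (fun y : ℝ => y) (η x) ∧ ∫ y, y ∂(η x) = f x ∧
        ∫⁻ y, ENNReal.ofReal (|y - f x| ^ 2) ∂(η x) ≤ ENNReal.ofReal (σ ^ 2)

end Model

/-! ### Parameter choice and rate -/

/-- `λ_n = min ((σ² / (R² n)) ^ (b / (2br + b + 1)), 1)`. -/
def lamSeq (b r σ R : ℝ) (n : ℕ) : ℝ :=
  min ((σ ^ 2 / (R ^ 2 * n)) ^ (b / (2 * b * r + b + 1))) 1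

/-- `a_n = R (σ² / (R² n)) ^ (b (r + s) / (2br + b + 1))`. -/
def rate (b r s σ R : ℝ) (n : ℕ) : ℝ :=
  R * (σ ^ 2 / (R ^ 2 * n)) ^ (b * (r + s) / (2 * b * r + b + 1))

end DistLearn

end

noncomputable section

namespace DistLearn

open scoped InnerProductSpace TensorProduct

universe u v

set_option linter.unusedSectionVars false

/-! Write `T` for the covariance operator, `T'` for the empirical one of a block, `ρ(t) = 1 - g_λ(t)
t`, and `f = T^r h`. The error is the average over the blocks of `ρ(T') f`, so the triangle
inequality reduces everything to the operator norm of `T^s ρ(T') T^r` for a single block; no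
cancellation between blocks is used.

Inserting powers of `T + λ` and `T' + λ` splits this product into five factors (`norm_approx_le`).
The outer two are contractions, and the middle one, `(T'+λ)^s ρ(T') (T'+λ)^r`, is of order `λ^(r+s)`
by the qualification (`norm_residual_le`). The remaining two compare powers of `T + λ` and `T' + λ`.
They are bounded as soon as `‖(T+λ)⁻¹(T - T')‖ ≤ λ^(max r 1 - 1) / 2`: for exponents up to 1 by the
Löwner–Heinz inequality (`norm_op_rpow_le`), beyond that by telescoping
(`norm_neg_shiftPow_mul_le`).

It remains to see that this smallness fails rarely. The operator norm is dominated by the norm of a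
sum of independent centred vectors in the tensor square of `H`. A Rosenthal type bound for moments
of order `2k` (`exists_moment_sum_le`) and Markov's inequality control the failure probability
(`exists_measure_centTensor_le`). The variance is at most `λ^(-1-θ) ∑ μ_j^θ`, where the sum
converges for every `θ > 1/b` by the eigenvalue decay. With blocks of size at least `n^(1-α)`, the
condition on `α` says exactly that, for `θ` close to `1/b`, the ratio of variance to squared
threshold is `O(n^(-δ))` for some `δ > 0` (`exists_exponents`). Taking `k` large beats both the
union bound over at most `n` blocks and the factor lost on the bad event, where only `‖ρ(T')‖ ≤ γ₀`
is available. The resulting constant does not involve `σ` or `R`. -/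

theorem _root_.HasSum.of_forall_eq {ι E : Type*} [AddCommMonoid E] [TopologicalSpace E]
    {f g : ι → E} {a : E} (hf : HasSum f a) (h : ∀ i, g i = f i) : HasSum g a := by
  rwa [funext h]

/-! ### Functional calculus in a Hilbert basis of eigenvectors. -/

section Diagonal

variable {H : Type u} [NormedAddCommGroup H] [InnerProductSpace ℝ H]

theorem _root_.HilbertBasis.hasSum_inner_sq {ι : Type*} (e : HilbertBasis ι ℝ H) (v : H) :
    HasSum (fun i => ⟪e i, v⟫_ℝ ^ 2) (‖v‖ ^ 2) := by
  have h := e.hasSum_inner_mul_inner v v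
  rw [real_inner_self_eq_norm_sq] at h
  have hf : (fun i => ⟪e i, v⟫_ℝ ^ 2) = fun i => ⟪v, e i⟫_ℝ * ⟪e i, v⟫_ℝ := by
    funext i
    rw [real_inner_comm v, sq]
  rwa [hf]

theorem _root_.HilbertBasis.ext_inner {ι : Type*} (e : HilbertBasis ι ℝ H) {v w : H}
    (h : ∀ i, ⟪e i, v⟫_ℝ = ⟪e i, w⟫_ℝ) : v = w := by
  apply e.repr.injective
  ext i
  simpa [e.repr_apply_apply] using h i

theorem exists_diagonal {ι : Type*} (e : HilbertBasis ι ℝ H) (a : ι → ℝ) {C : ℝ} (hC : 0 ≤ C)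
    (ha : ∀ i, |a i| ≤ C) :
    ∃ D : H →L[ℝ] H, ∀ i v, ⟪e i, D v⟫_ℝ = a i * ⟪e i, v⟫_ℝ := by
  have hsq : ∀ i (x : ℝ), (a i * x) ^ 2 ≤ C ^ 2 * x ^ 2 := fun i x => by
    rw [mul_pow]
    exact mul_le_mul_of_nonneg_right
      (sq_le_sq' (abs_le.1 (ha i)).1 (abs_le.1 (ha i)).2) (sq_nonneg x)
  have hmem : ∀ v : H, Memℓp (fun i => a i * ⟪e i, v⟫_ℝ) 2 := fun v => by
    refine memℓp_gen ?_
    simp only [ENNReal.toReal_ofNat, Real.rpow_ofNat, Real.norm_eq_abs, sq_abs]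
    exact Summable.of_nonneg_of_le (fun i => sq_nonneg _) (fun i => hsq i _)
      ((e.hasSum_inner_sq v).summable.mul_left _)
  let L : H →ₗ[ℝ] H :=
    { toFun := fun v => e.repr.symm ⟨_, hmem v⟩
      map_add' := fun v w => by
        rw [← map_add]
        congr 1
        ext i
        simp only [inner_add_right, mul_add]
        rfl
      map_smul' := fun c v => by
        rw [RingHom.id_apply, ← map_smul]
        congr 1
        ext i
        simp [inner_smul_right]
        ring }
  have hL : ∀ i v, ⟪e i, L v⟫_ℝ = a i * ⟪e i, v⟫_ℝ := fun i v => by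
    rw [← e.repr_apply_apply]
    simp [L]
  refine ⟨L.mkContinuous C fun v => ?_, fun i v => by simpa using hL i v⟩
  refine abs_le_of_sq_le_sq' ?_ (by positivity) |>.2
  rw [mul_pow]
  refine hasSum_le (fun i => ?_) (e.hasSum_inner_sq (L v)) ((e.hasSum_inner_sq v).mul_left (C ^ 2))
  rw [hL]
  exact hsq i _

variable [CompleteSpace H]

/-- A Hilbert basis of eigenvectors of `T`, all eigenvalues lying in `[0, 1]`. -/
structure Eigenbasis (T : H →L[ℝ] H) where
  /-- the index type -/
  ι : Type u
  /-- the eigenvectors -/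
  basis : HilbertBasis ι ℝ H
  /-- the eigenvalues -/
  val : ι → ℝ
  val_mem : ∀ i, val i ∈ Set.Icc (0 : ℝ) 1
  apply_basis : ∀ i, T (basis i) = val i • basis i

/-- Boundedness on the spectral interval `[0, 1]`. -/
def BddUnit (φ : ℝ → ℝ) : Prop := ∃ C : ℝ, ∀ t ∈ Set.Icc (0 : ℝ) 1, |φ t| ≤ C

theorem BddUnit.mul {φ ψ : ℝ → ℝ} (hφ : BddUnit φ) (hψ : BddUnit ψ) :
    BddUnit fun t => φ t * ψ t := by
  obtain ⟨C, hC⟩ := hφ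
  obtain ⟨D, hD⟩ := hψ
  refine ⟨C * D, fun t ht => ?_⟩
  rw [abs_mul]
  exact mul_le_mul (hC t ht) (hD t ht) (abs_nonneg _) ((abs_nonneg _).trans (hC t ht))

theorem BddUnit.add {φ ψ : ℝ → ℝ} (hφ : BddUnit φ) (hψ : BddUnit ψ) :
    BddUnit fun t => φ t + ψ t := by
  obtain ⟨C, hC⟩ := hφ
  obtain ⟨D, hD⟩ := hψ
  exact ⟨C + D, fun t ht => (abs_add_le _ _).trans (add_le_add (hC t ht) (hD t ht))⟩

theorem BddUnit.of_continuousOn {φ : ℝ → ℝ} (h : ContinuousOn φ (Set.Icc 0 1)) : BddUnit φ := by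
  obtain ⟨C, hC⟩ := isCompact_Icc.exists_bound_of_continuousOn h
  exact ⟨C, hC⟩

theorem bddUnit_const (c : ℝ) : BddUnit fun _ => c := ⟨|c|, fun _ _ => le_rfl⟩

theorem bddUnit_id : BddUnit fun t => t := .of_continuousOn continuousOn_id

namespace Eigenbasis

variable {T : H →L[ℝ] H} (d : Eigenbasis T)

open Classical in
/-- The function `φ(T)` of an operator with an eigenbasis, for `φ` bounded on `[0, 1]`. -/
def op (φ : ℝ → ℝ) : H →L[ℝ] H :=
  if h : BddUnit φ then
    (exists_diagonal d.basis (fun i => φ (d.val i)) (C := h.choose)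
      ((abs_nonneg _).trans (h.choose_spec 0 (by simp)))
      (fun i => h.choose_spec _ (d.val_mem i))).choose
  else 0

theorem inner_op {φ : ℝ → ℝ} (h : BddUnit φ) (i : d.ι) (v : H) :
    ⟪d.basis i, d.op φ v⟫_ℝ = φ (d.val i) * ⟪d.basis i, v⟫_ℝ := by
  rw [op, dif_pos h]
  exact (exists_diagonal d.basis (fun i => φ (d.val i)) (C := h.choose)
      ((abs_nonneg _).trans (h.choose_spec 0 (by simp)))
      (fun i => h.choose_spec _ (d.val_mem i))).choose_spec i v

theorem op_comp {φ ψ : ℝ → ℝ} (hφ : BddUnit φ) (hψ : BddUnit ψ) :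
    d.op φ * d.op ψ = d.op fun t => φ t * ψ t := by
  ext v
  refine d.basis.ext_inner fun i => ?_
  rw [mul_apply_eq_comp, d.inner_op hφ, d.inner_op hψ, d.inner_op (hφ.mul hψ), mul_assoc]

theorem op_congr {φ ψ : ℝ → ℝ} (h : ∀ t ∈ Set.Icc (0 : ℝ) 1, φ t = ψ t) : d.op φ = d.op ψ := by
  have hb : BddUnit φ ↔ BddUnit ψ := by
    constructor <;> rintro ⟨C, hC⟩ <;> refine ⟨C, fun t ht => ?_⟩
    · rw [← h t ht]; exact hC t ht
    · rw [h t ht]; exact hC t ht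
  by_cases hφ : BddUnit φ
  · ext v
    refine d.basis.ext_inner fun i => ?_
    rw [d.inner_op hφ, d.inner_op (hb.1 hφ), h _ (d.val_mem i)]
  · rw [op, op, dif_neg hφ, dif_neg (fun h' => hφ (hb.2 h'))]

theorem op_add {φ ψ : ℝ → ℝ} (hφ : BddUnit φ) (hψ : BddUnit ψ) :
    d.op φ + d.op ψ = d.op fun t => φ t + ψ t := by
  ext v
  refine d.basis.ext_inner fun i => ?_
  rw [add_apply, inner_add_right, d.inner_op hφ, d.inner_op hψ,
    d.inner_op (hφ.add hψ), add_mul]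

theorem op_symm (φ : ℝ → ℝ) (v w : H) : ⟪d.op φ v, w⟫_ℝ = ⟪v, d.op φ w⟫_ℝ := by
  by_cases h : BddUnit φ
  · rw [← d.basis.tsum_inner_mul_inner, ← d.basis.tsum_inner_mul_inner]
    congr 1
    ext i
    rw [real_inner_comm, d.inner_op h, d.inner_op h, real_inner_comm (d.basis i) v]
    ring
  · simp [op, dif_neg h]

theorem adjoint_op (φ : ℝ → ℝ) : ContinuousLinearMap.adjoint (d.op φ) = d.op φ :=
  ((ContinuousLinearMap.eq_adjoint_iff _ _).2 (d.op_symm φ)).symm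

theorem op_const (c : ℝ) : d.op (fun _ => c) = c • (1 : H →L[ℝ] H) := by
  ext v
  refine d.basis.ext_inner fun i => ?_
  rw [d.inner_op (bddUnit_const c)]
  simp [inner_smul_right]

theorem inner_apply (i : d.ι) (v : H) : ⟪d.basis i, T v⟫_ℝ = d.val i * ⟪d.basis i, v⟫_ℝ := by
  have h1 := (T.hasSum ((d.basis.hasSum_repr v))).mapL (innerSL ℝ (d.basis i))
  have h2 := ((d.basis.hasSum_repr v).mapL (innerSL ℝ (d.basis i))).mul_left (d.val i)
  refine h1.unique ?_
  refine h2.of_forall_eq fun j => ?_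
  simp only [map_smul, d.apply_basis, innerSL_apply_apply, smul_eq_mul]
  by_cases hij : i = j
  · subst hij; ring
  · rw [d.basis.orthonormal.2 hij]; simp

theorem op_id : d.op (fun t => t) = T := by
  ext v
  refine d.basis.ext_inner fun i => ?_
  rw [d.inner_op bddUnit_id, d.inner_apply]

theorem hasSum_op_sq {φ : ℝ → ℝ} (h : BddUnit φ) (v : H) :
    HasSum (fun i => φ (d.val i) ^ 2 * ⟪d.basis i, v⟫_ℝ ^ 2) (‖d.op φ v‖ ^ 2) := by
  have := d.basis.hasSum_inner_sq (d.op φ v)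
  simpa only [d.inner_op h, mul_pow] using this

theorem norm_op_le {φ : ℝ → ℝ} {C : ℝ} (h : ∀ t ∈ Set.Icc (0 : ℝ) 1, |φ t| ≤ C) :
    ‖d.op φ‖ ≤ C := by
  have hC : 0 ≤ C := (abs_nonneg _).trans (h 0 (by simp))
  refine ContinuousLinearMap.opNorm_le_bound _ hC fun v => ?_
  refine abs_le_of_sq_le_sq' ?_ (by positivity) |>.2
  rw [mul_pow]
  refine hasSum_le (fun i => ?_) (d.hasSum_op_sq ⟨C, h⟩ v)
    ((d.basis.hasSum_inner_sq v).mul_left (C ^ 2))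
  have := abs_le.1 (h _ (d.val_mem i))
  exact mul_le_mul_of_nonneg_right (sq_le_sq' this.1 this.2) (sq_nonneg _)

theorem isSymmetric (d : Eigenbasis T) : (T : H →ₗ[ℝ] H).IsSymmetric := fun v w => by
  have := d.op_symm (fun t => t) v w
  rwa [d.op_id] at this

theorem starProjection_basis (d : Eigenbasis T) (μ : ℝ) (i : d.ι) :
    (eigSpace T μ).starProjection (d.basis i) = if d.val i = μ then d.basis i else 0 := by
  have hi : d.basis i ∈ eigSpace T (d.val i) := by
    rw [Module.End.mem_eigenspace_iff]
    exact d.apply_basis i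
  split_ifs with h
  · subst h
    exact Submodule.starProjection_eq_self_iff.2 hi
  · refine (Submodule.starProjection_apply_eq_zero_iff _).2 ?_
    have := d.isSymmetric.orthogonalFamily_eigenspaces.isOrtho h
    exact this hi

/-- Grouping the basis expansion of `φ(T) v` by the value of the eigenvalue turns each fibre sum
into a spectral projection. This is the bridge from the definitions in the statement to bounded
operators with an algebra of products. -/
theorem specFun_eq (d : Eigenbasis T) {φ : ℝ → ℝ} (h : BddUnit φ) (v : H) :
    specFun φ T v = d.op φ v := by
  have h1 : HasSum (fun i => (φ (d.val i) * ⟪d.basis i, v⟫_ℝ) • d.basis i) (d.op φ v) := by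
    have := d.basis.hasSum_repr (d.op φ v)
    simpa only [d.basis.repr_apply_apply, d.inner_op h] using this
  have h2 : ∀ μ : ℝ, HasSum (fun i : {i // d.val i = μ} =>
      (φ (d.val i) * ⟪d.basis i, v⟫_ℝ) • d.basis i) (φ μ • (eigSpace T μ).starProjection v) := by
    intro μ
    have h3 := (((d.basis.hasSum_repr v).mapL (eigSpace T μ).starProjection)).const_smul (φ μ)
    rw [← hasSum_subtype_iff_of_support_subset (s := {i | d.val i = μ})] at h3
    · refine h3.of_forall_eq fun j => ?_
      have hj : d.val j = μ := j.2
      simp [Function.comp, d.starProjection_basis, hj, d.basis.repr_apply_apply, mul_smul]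
    · intro i hi
      by_contra hne
      refine hi ?_
      have hne' : d.val i ≠ μ := hne
      simp [d.starProjection_basis, hne']
  rw [← (Equiv.sigmaFiberEquiv d.val).hasSum_iff] at h1
  exact (h1.sigma h2).tsum_eq

end Eigenbasis

/-- The spectral theorem: Hilbert bases of the separate eigenspaces combine to an orthonormal
family, which is complete because the eigenspaces of a compact symmetric operator have trivial
common orthogonal complement. The eigenvalues are the values of the quadratic form at unit vectors,
hence lie in `[0, 1]`. -/
theorem nonempty_eigenbasis (T : H →L[ℝ] H) (hc : IsCompactOperator T)
    (hs : (T : H →ₗ[ℝ] H).IsSymmetric) (hpos : ∀ v, 0 ≤ ⟪T v, v⟫_ℝ) (h1 : ‖T‖ ≤ 1) :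
    Nonempty (Eigenbasis T) := by
  choose w b hb using fun μ : ℝ => exists_hilbertBasis ℝ (eigSpace T μ)
  let v : (Σ μ : ℝ, w μ) → H := fun x => (b x.1 x.2 : H)
  have hv : Orthonormal ℝ v :=
    hs.orthogonalFamily_eigenspaces.orthonormal_sigma_orthonormal fun μ => (b μ).orthonormal
  have hbot : (Submodule.span ℝ (Set.range v))ᗮ = ⊥ := by
    rw [eq_bot_iff, ← ContinuousLinearMap.orthogonalComplement_iSup_eigenspaces_eq_bot hc hs,
      ← Submodule.iInf_orthogonal]
    intro x hx
    refine Submodule.mem_iInf _ |>.2 fun μ => ?_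
    rw [← Submodule.starProjection_apply_eq_zero_iff, Submodule.starProjection_apply]
    have : (eigSpace T μ).orthogonalProjectionOnto x = 0 := by
      refine (b μ).ext_inner fun i => ?_
      rw [inner_zero_right, Submodule.inner_orthogonalProjectionOnto_eq_of_mem_left]
      exact (Submodule.mem_orthogonal _ _).1 hx _ (Submodule.subset_span ⟨⟨μ, i⟩, rfl⟩)
    rw [this]; rfl
  let e := HilbertBasis.mkOfOrthogonalEqBot hv hbot
  have he : ∀ x, e x = v x := fun x => by rw [HilbertBasis.coe_mkOfOrthogonalEqBot]
  have hTe : ∀ x, T (e x) = x.1 • e x := fun x => by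
    have := (b x.1 x.2).2
    rw [Module.End.mem_eigenspace_iff] at this
    rw [he]
    exact this
  have hval : ∀ x, ⟪T (e x), e x⟫_ℝ = x.1 := fun x => by
    rw [hTe, real_inner_smul_left, real_inner_self_eq_norm_sq, e.orthonormal.1]
    norm_num
  refine ⟨⟨_, e, fun x => x.1, fun x => ⟨?_, ?_⟩, hTe⟩⟩
  · rw [← hval]; exact hpos _
  · rw [← hval x]
    refine (real_inner_le_norm _ _).trans ?_
    have := T.le_opNorm (e x)
    rw [e.orthonormal.1] at this ⊢
    linarith

end Diagonal

/-! ### The Löwner–Heinz inequality. -/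

section Heinz

variable {H : Type u} [NormedAddCommGroup H] [InnerProductSpace ℝ H]

/-- Distinct members are at distance `√2`, so balls of radius `1/2` around them are disjoint.
Countability is what permits exchanging basis sums with integrals later. -/
theorem _root_.Orthonormal.countable [TopologicalSpace.SeparableSpace H] {ι : Type*} {e : ι → H}
    (he : Orthonormal ℝ e) : Countable ι := by
  refine Pairwise.countable_of_isOpen_disjoint (s := fun i => Metric.ball (e i) (1 / 2)) ?_
    (fun i => Metric.isOpen_ball) (fun i => ⟨e i, Metric.mem_ball_self (by norm_num)⟩)
  intro i j hij
  refine Metric.ball_disjoint_ball ?_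
  rw [dist_eq_norm]
  have h : ‖e i - e j‖ ^ 2 = 2 := by
    rw [norm_sub_sq_real, he.1, he.1, he.2 hij]
    norm_num
  nlinarith [norm_nonneg (e i - e j)]

variable [CompleteSpace H]

/-- The quotient `a² / (τ + a²)`, the minimum of `(1 - z)² + a² z² / τ` over `z`. -/
def tikhonov (τ a : ℝ) : ℝ := a ^ 2 / (τ + a ^ 2)

theorem tikhonov_nonneg {τ : ℝ} (hτ : 0 < τ) (a : ℝ) : 0 ≤ tikhonov τ a := by
  unfold tikhonov; positivity

theorem tikhonov_le_one {τ : ℝ} (hτ : 0 < τ) (a : ℝ) : tikhonov τ a ≤ 1 := by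
  unfold tikhonov
  rw [div_le_one (by positivity)]
  linarith

theorem tikhonov_mul_sq_le {τ : ℝ} (hτ : 0 < τ) (a x z : ℝ) :
    tikhonov τ a * x ^ 2 ≤ (x - z) ^ 2 + a ^ 2 * z ^ 2 / τ := by
  have h : (x - z) ^ 2 + a ^ 2 * z ^ 2 / τ - tikhonov τ a * x ^ 2 =
      (τ * x - (τ + a ^ 2) * z) ^ 2 / (τ * (τ + a ^ 2)) := by
    unfold tikhonov
    have : τ + a ^ 2 ≠ 0 := by positivity
    field_simp
    ring
  have : 0 ≤ (τ * x - (τ + a ^ 2) * z) ^ 2 / (τ * (τ + a ^ 2)) := by positivity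
  linarith

theorem tikhonov_mul_sq_eq {τ : ℝ} (hτ : 0 < τ) (a x : ℝ) :
    (x - τ / (τ + a ^ 2) * x) ^ 2 + a ^ 2 * (τ / (τ + a ^ 2) * x) ^ 2 / τ =
      tikhonov τ a * x ^ 2 := by
  unfold tikhonov
  have : τ + a ^ 2 ≠ 0 := by positivity
  field_simp
  ring

theorem bddUnit_sqrt_tikhonov {τ : ℝ} (hτ : 0 < τ) (φ : ℝ → ℝ) :
    BddUnit fun t => √(tikhonov τ (φ t)) :=
  ⟨1, fun t _ => by
    rw [abs_of_nonneg (Real.sqrt_nonneg _)]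
    exact Real.sqrt_le_one.2 (tikhonov_le_one hτ _)⟩

theorem hasSum_tikhonov {T : H →L[ℝ] H} (d : Eigenbasis T) {τ : ℝ} (hτ : 0 < τ) (φ : ℝ → ℝ)
    (x : H) : HasSum (fun i => tikhonov τ (φ (d.val i)) * ⟪d.basis i, x⟫_ℝ ^ 2)
      (‖d.op (fun t => √(tikhonov τ (φ t))) x‖ ^ 2) := by
  refine (d.hasSum_op_sq (bddUnit_sqrt_tikhonov hτ φ) x).of_forall_eq fun i => ?_
  rw [Real.sq_sqrt (tikhonov_nonneg hτ _)]

/-- The left side is the minimum over `z` of `‖x - z‖² + ‖φ(T) z‖² / τ`, and likewise on the right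
with `ψ(T')`. Testing the first minimum with the minimiser `z` of the second transfers the
hypothesis; `1 ≤ C` absorbs the term `‖x - z‖²`. -/
theorem norm_tikhonov_le {T T' : H →L[ℝ] H} (d : Eigenbasis T) (d' : Eigenbasis T') {φ ψ : ℝ → ℝ}
    (hφ : BddUnit φ) (hψ : BddUnit ψ) {C : ℝ} (hC : 1 ≤ C)
    (h : ∀ x, ‖d.op φ x‖ ≤ C * ‖d'.op ψ x‖) {τ : ℝ} (hτ : 0 < τ) (x : H) :
    ‖d.op (fun t => √(tikhonov τ (φ t))) x‖ ^ 2 ≤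
      C ^ 2 * ‖d'.op (fun t => √(tikhonov τ (ψ t))) x‖ ^ 2 := by
  have hw : BddUnit fun t => τ / (τ + ψ t ^ 2) := ⟨1, fun t _ => by
    rw [abs_of_nonneg (by positivity), div_le_one (by positivity)]
    linarith [sq_nonneg (ψ t)]⟩
  set z := d'.op (fun t => τ / (τ + ψ t ^ 2)) x with hz
  have h1 : ‖d.op (fun t => √(tikhonov τ (φ t))) x‖ ^ 2 ≤ ‖x - z‖ ^ 2 + ‖d.op φ z‖ ^ 2 / τ := by
    refine hasSum_le (fun i => ?_) (hasSum_tikhonov d hτ φ x)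
      ((d.basis.hasSum_inner_sq (x - z)).add ((d.hasSum_op_sq hφ z).div_const τ))
    rw [inner_sub_right]
    exact tikhonov_mul_sq_le hτ _ _ _
  have h2 : ‖x - z‖ ^ 2 + ‖d'.op ψ z‖ ^ 2 / τ =
      ‖d'.op (fun t => √(tikhonov τ (ψ t))) x‖ ^ 2 := by
    refine HasSum.unique ?_ (hasSum_tikhonov d' hτ ψ x)
    refine ((d'.basis.hasSum_inner_sq (x - z)).add
      ((d'.hasSum_op_sq hψ z).div_const τ)).of_forall_eq fun i => ?_
    rw [inner_sub_right, hz, d'.inner_op hw, tikhonov_mul_sq_eq hτ]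
  rw [← h2]
  refine h1.trans ?_
  have h3 : ‖d.op φ z‖ ^ 2 ≤ C ^ 2 * ‖d'.op ψ z‖ ^ 2 := by
    rw [← mul_pow]
    exact pow_le_pow_left₀ (norm_nonneg _) (h z) 2
  have h4 : ‖x - z‖ ^ 2 ≤ C ^ 2 * ‖x - z‖ ^ 2 :=
    le_mul_of_one_le_left (sq_nonneg _) (one_le_pow₀ hC)
  rw [mul_add, ← mul_div_assoc]
  gcongr

theorem bddUnit_rpow {φ : ℝ → ℝ} (hφ : BddUnit φ) (h0 : ∀ t ∈ Set.Icc (0 : ℝ) 1, 0 ≤ φ t) {θ : ℝ}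
    (hθ : 0 ≤ θ) : BddUnit fun t => φ t ^ θ := by
  obtain ⟨C, hC⟩ := hφ
  refine ⟨C ^ θ, fun t ht => ?_⟩
  rw [abs_of_nonneg (Real.rpow_nonneg (h0 t ht) _)]
  exact Real.rpow_le_rpow (h0 t ht) ((le_abs_self _).trans (hC t ht)) hθ

/-- The scalar formula `a^(2θ) = ∫ τ^(θ-1) a² / (τ + a²) dμ(τ)` is applied to each coordinate and
summed. Nonnegative extended integrals make the exchange of sum and integral free of integrability
conditions. -/
theorem exists_measure_norm_op_rpow_sq [TopologicalSpace.SeparableSpace H] {θ : ℝ}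
    (hθ : θ ∈ Set.Ioo (0 : ℝ) 1) :
    ∃ μ : Measure ℝ, ∀ {T : H →L[ℝ] H} (d : Eigenbasis T) {φ : ℝ → ℝ}, BddUnit φ →
      (∀ t ∈ Set.Icc (0 : ℝ) 1, 0 ≤ φ t) → ∀ x : H,
        ENNReal.ofReal (‖d.op (fun t => φ t ^ θ) x‖ ^ 2) =
          ∫⁻ τ in Set.Ioi 0, ENNReal.ofReal (τ ^ (θ - 1)) *
            ENNReal.ofReal (‖d.op (fun t => √(tikhonov τ (φ t))) x‖ ^ 2) ∂μ := by
  obtain ⟨μ, hμ⟩ := Real.exists_measure_rpow_eq_integral_rpowIntegrand₀₁ hθ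
  refine ⟨μ, fun {T} d {φ} hφ h0 x => ?_⟩
  have := d.basis.orthonormal.countable
  have key : ∀ a : ℝ, 0 ≤ a → ENNReal.ofReal ((a ^ θ) ^ 2) =
      ∫⁻ τ in Set.Ioi 0, ENNReal.ofReal (τ ^ (θ - 1)) * ENNReal.ofReal (tikhonov τ a) ∂μ := by
    intro a ha
    obtain ⟨hi, he⟩ := hμ (a ^ 2) (sq_nonneg a)
    have h1 : (a ^ θ) ^ 2 = (a ^ 2) ^ θ := by
      rw [← Real.rpow_natCast, ← Real.rpow_natCast, ← Real.rpow_mul ha, ← Real.rpow_mul ha, mul_comm]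
    rw [h1, he, ofReal_integral_eq_lintegral_ofReal hi]
    · refine setLIntegral_congr_fun measurableSet_Ioi fun τ hτ => ?_
      have hτ' : (0 : ℝ) < τ := hτ
      rw [Real.rpowIntegrand₀₁_eq_pow_div hθ hτ'.le (sq_nonneg a), ← ENNReal.ofReal_mul (by positivity),
        tikhonov, mul_div_assoc]
    · refine (ae_restrict_iff' measurableSet_Ioi).2 (Eventually.of_forall fun τ hτ => ?_)
      exact Real.rpowIntegrand₀₁_nonneg hθ.1 (le_of_lt hτ) (sq_nonneg a)
  have hs := d.hasSum_op_sq (bddUnit_rpow hφ h0 hθ.1.le) x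
  rw [← hs.tsum_eq, ENNReal.ofReal_tsum_of_nonneg (fun i => by positivity) hs.summable]
  have hr : ∀ τ ∈ Set.Ioi (0 : ℝ), ENNReal.ofReal (τ ^ (θ - 1)) *
      ENNReal.ofReal (‖d.op (fun t => √(tikhonov τ (φ t))) x‖ ^ 2) =
      ∑' i, ENNReal.ofReal (τ ^ (θ - 1)) * ENNReal.ofReal (tikhonov τ (φ (d.val i))) *
        ENNReal.ofReal (⟪d.basis i, x⟫_ℝ ^ 2) := by
    intro τ hτ
    have hs := hasSum_tikhonov d hτ φ x
    rw [← hs.tsum_eq, ENNReal.ofReal_tsum_of_nonneg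
      (fun i => mul_nonneg (tikhonov_nonneg hτ _) (sq_nonneg _)) hs.summable, ← ENNReal.tsum_mul_left]
    congr 1
    ext i
    rw [ENNReal.ofReal_mul (tikhonov_nonneg hτ _), mul_assoc]
  rw [setLIntegral_congr_fun measurableSet_Ioi hr, lintegral_tsum]
  · congr 1
    ext i
    rw [lintegral_mul_const _ (by unfold tikhonov; fun_prop), ← key _ (h0 _ (d.val_mem i)),
      ENNReal.ofReal_mul (by positivity)]
  · intro i
    unfold tikhonov
    fun_prop

/-- The Löwner–Heinz inequality. -/
theorem norm_op_rpow_le [TopologicalSpace.SeparableSpace H] {T T' : H →L[ℝ] H} (d : Eigenbasis T)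
    (d' : Eigenbasis T') {φ ψ : ℝ → ℝ} (hφ : BddUnit φ) (hψ : BddUnit ψ)
    (hφ0 : ∀ t ∈ Set.Icc (0 : ℝ) 1, 0 ≤ φ t) (hψ0 : ∀ t ∈ Set.Icc (0 : ℝ) 1, 0 ≤ ψ t)
    {C : ℝ} (hC : 1 ≤ C) (h : ∀ x, ‖d.op φ x‖ ≤ C * ‖d'.op ψ x‖) {θ : ℝ}
    (hθ : θ ∈ Set.Icc (0 : ℝ) 1) (x : H) :
    ‖d.op (fun t => φ t ^ θ) x‖ ≤ C * ‖d'.op (fun t => ψ t ^ θ) x‖ := by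
  rcases hθ.1.eq_or_lt with rfl | h0
  · simp only [Real.rpow_zero, Eigenbasis.op_const]
    exact le_mul_of_one_le_left (norm_nonneg _) hC
  rcases hθ.2.eq_or_lt with rfl | h1
  · simpa only [Real.rpow_one] using h x
  obtain ⟨μ, hμ⟩ := exists_measure_norm_op_rpow_sq (H := H) (θ := θ) ⟨h0, h1⟩
  -- The comparison of the quadratic minima holds for each `τ` with the same constant `C ^ 2`, so it
  -- survives integration against the common measure.
  have hsq : ENNReal.ofReal (‖d.op (fun t => φ t ^ θ) x‖ ^ 2) ≤
      ENNReal.ofReal (C ^ 2 * ‖d'.op (fun t => ψ t ^ θ) x‖ ^ 2) := by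
    rw [ENNReal.ofReal_mul (by positivity), hμ d hφ hφ0, hμ d' hψ hψ0,
      ← lintegral_const_mul' _ _ ENNReal.ofReal_ne_top]
    refine setLIntegral_mono' measurableSet_Ioi fun τ hτ => ?_
    rw [mul_left_comm, ← ENNReal.ofReal_mul (by positivity : (0 : ℝ) ≤ C ^ 2)]
    gcongr
    exact norm_tikhonov_le d d' hφ hψ hC h hτ x
  rw [ENNReal.ofReal_le_ofReal_iff (by positivity), ← mul_pow] at hsq
  exact abs_le_of_sq_le_sq' hsq (by positivity) |>.2

end Heinz

/-! ### Deterministic bounds for perturbed spectral methods. -/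

section Perturbation

variable {H : Type u} [NormedAddCommGroup H] [InnerProductSpace ℝ H] [CompleteSpace H]

theorem norm_mul_swap_of_adjoint_eq {P Q : H →L[ℝ] H} (hP : ContinuousLinearMap.adjoint P = P)
    (hQ : ContinuousLinearMap.adjoint Q = Q) : ‖P * Q‖ = ‖Q * P‖ := by
  rw [← LinearIsometryEquiv.norm_map ContinuousLinearMap.adjoint (P * Q),
    ContinuousLinearMap.mul_def, ContinuousLinearMap.adjoint_comp, hP, hQ]
  rfl

theorem mul_mul_eq_of_mul_eq_one {M : Type*} [Monoid M] {a a' b b' c c' e e' : M}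
    (ha : a * a' = 1) (hb : b * b' = 1) (hc : c * c' = 1) (he : e * e' = 1) (x y z : M) :
    x * y * z = (x * a) * (a' * b) * (b' * y * c) * (c' * e) * (e' * z) := by
  have h : (x * a) * (a' * b) * (b' * y * c) * (c' * e) * (e' * z) =
      x * (a * a') * (b * b') * y * (c * c') * (e * e') * z := by
    simp only [mul_assoc]
  rw [h, ha, hb, hc, he]
  simp only [mul_one]

namespace Eigenbasis

variable {T : H →L[ℝ] H} (d : Eigenbasis T)

/-- The power `(T + l)^w`. -/
def shiftPow (l w : ℝ) : H →L[ℝ] H := d.op fun t => (t + l) ^ w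

variable {l : ℝ}

theorem bddUnit_shift (hl : 0 < l) (w : ℝ) : BddUnit fun t => (t + l) ^ w :=
  .of_continuousOn <| ContinuousOn.rpow_const (by fun_prop) fun t ht =>
    .inl (add_pos_of_nonneg_of_pos ht.1 hl).ne'

theorem shiftPow_mul (hl : 0 < l) (v w : ℝ) :
    d.shiftPow l v * d.shiftPow l w = d.shiftPow l (v + w) := by
  rw [shiftPow, shiftPow, d.op_comp (bddUnit_shift hl v) (bddUnit_shift hl w)]
  exact d.op_congr fun t ht => (Real.rpow_add (add_pos_of_nonneg_of_pos ht.1 hl) _ _).symm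

theorem shiftPow_zero : d.shiftPow l 0 = 1 := by
  simp only [shiftPow, Real.rpow_zero, d.op_const, one_smul]

theorem shiftPow_one : d.shiftPow l 1 = T + l • 1 := by
  simp only [shiftPow, Real.rpow_one, ← d.op_add bddUnit_id (bddUnit_const l), d.op_id, d.op_const]

theorem norm_shiftPow_le_of_nonneg (hl : l ∈ Set.Ioc (0 : ℝ) 1) {w : ℝ} (hw : 0 ≤ w) :
    ‖d.shiftPow l w‖ ≤ 2 ^ w :=
  d.norm_op_le fun t ht => by
    have h0 : 0 < t + l := add_pos_of_nonneg_of_pos ht.1 hl.1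
    rw [abs_of_nonneg (by positivity)]
    exact Real.rpow_le_rpow h0.le (by linarith [ht.2, hl.2]) hw

theorem norm_shiftPow_le_of_nonpos (hl : 0 < l) {w : ℝ} (hw : w ≤ 0) :
    ‖d.shiftPow l w‖ ≤ l ^ w :=
  d.norm_op_le fun t ht => by
    have h0 : 0 < t + l := add_pos_of_nonneg_of_pos ht.1 hl
    rw [abs_of_nonneg (by positivity)]
    exact Real.rpow_le_rpow_of_nonpos hl (by linarith [ht.1]) hw

theorem adjoint_shiftPow (w : ℝ) : ContinuousLinearMap.adjoint (d.shiftPow l w) = d.shiftPow l w :=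
  d.adjoint_op _

variable {T' : H →L[ℝ] H} (d' : Eigenbasis T')

theorem shiftPow_neg_mul_self (hl : 0 < l) (w : ℝ) : d.shiftPow l (-w) * d.shiftPow l w = 1 := by
  rw [d.shiftPow_mul hl, neg_add_cancel, d.shiftPow_zero]

theorem shiftPow_self_mul_neg (hl : 0 < l) (w : ℝ) : d.shiftPow l w * d.shiftPow l (-w) = 1 := by
  rw [d.shiftPow_mul hl, add_neg_cancel, d.shiftPow_zero]

theorem shiftPow_one_sub : d.shiftPow l 1 - d'.shiftPow l 1 = T - T' := by
  rw [shiftPow_one, shiftPow_one]; abel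

/-- The product `N` solves `N = 1 + N (T+l)⁻¹(T - T')`, so `‖N‖ ≤ 1 + ‖N‖ / 2` and the last term can
be absorbed. -/
theorem norm_resolvent_mul_le_two (hl : 0 < l) (h : ‖d.shiftPow l (-1) * (T - T')‖ ≤ 1 / 2) :
    ‖d'.shiftPow l (-1) * d.shiftPow l 1‖ ≤ 2 := by
  set N := d'.shiftPow l (-1) * d.shiftPow l 1 with hN
  have h1 : N = 1 + N * (d.shiftPow l (-1) * (T - T')) := by
    rw [hN, mul_assoc, ← mul_assoc (d.shiftPow l 1), d.shiftPow_self_mul_neg hl, one_mul,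
      ← d.shiftPow_one_sub d' (l := l), mul_sub, d'.shiftPow_neg_mul_self hl]
    abel
  have h2 : ‖N‖ ≤ 1 + ‖N‖ * (1 / 2) := by
    calc ‖N‖ = ‖1 + N * (d.shiftPow l (-1) * (T - T'))‖ := by rw [← h1]
      _ ≤ ‖(1 : H →L[ℝ] H)‖ + ‖N * (d.shiftPow l (-1) * (T - T'))‖ := norm_add_le _ _
      _ ≤ 1 + ‖N‖ * (1 / 2) := by
        gcongr
        · exact ContinuousLinearMap.norm_id_le
        · exact (norm_mul_le _ _).trans (by gcongr)
  linarith

/-- The case `θ = 1` is the adjoint of the resolvent bound; Löwner–Heinz then passes to smaller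
exponents without changing the constant 2. -/
theorem norm_shiftPow_mul_neg_le_two [TopologicalSpace.SeparableSpace H] (hl : 0 < l)
    (h : ‖d.shiftPow l (-1) * (T - T')‖ ≤ 1 / 2) {θ : ℝ} (hθ : θ ∈ Set.Icc (0 : ℝ) 1) :
    ‖d.shiftPow l θ * d'.shiftPow l (-θ)‖ ≤ 2 := by
  have h1 : ‖d.shiftPow l 1 * d'.shiftPow l (-1)‖ ≤ 2 := by
    rw [norm_mul_swap_of_adjoint_eq (d.adjoint_shiftPow _) (d'.adjoint_shiftPow _)]
    exact d.norm_resolvent_mul_le_two d' hl h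
  have h2 : ∀ x, ‖d.shiftPow l 1 x‖ ≤ 2 * ‖d'.shiftPow l 1 x‖ := fun x => by
    have h3 : d.shiftPow l 1 x = (d.shiftPow l 1 * d'.shiftPow l (-1)) (d'.shiftPow l 1 x) := by
      rw [← mul_apply_eq_comp, mul_assoc, d'.shiftPow_neg_mul_self hl, mul_one]
    rw [h3]
    exact (ContinuousLinearMap.le_opNorm _ _).trans (by gcongr)
  have hpow : ∀ {S : H →L[ℝ] H} (e : Eigenbasis S),
      e.op (fun t => ((t + l) ^ (1 : ℝ)) ^ θ) = e.shiftPow l θ := fun e => by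
    simp only [Real.rpow_one]; rfl
  have h0 : ∀ t ∈ Set.Icc (0 : ℝ) 1, 0 ≤ (t + l) ^ (1 : ℝ) := fun t ht =>
    Real.rpow_nonneg (by linarith [ht.1]) _
  refine ContinuousLinearMap.opNorm_le_bound _ (by norm_num) fun x => ?_
  have h4 := norm_op_rpow_le d d' (bddUnit_shift hl 1) (bddUnit_shift hl 1) h0 h0 one_le_two h2 hθ
    (d'.shiftPow l (-θ) x)
  rw [hpow, hpow, ← mul_apply_eq_comp, ← mul_apply_eq_comp, d'.shiftPow_self_mul_neg hl] at h4
  exact h4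

/-- Löwner–Heinz stops at exponent 1, so larger exponents are reached by unit steps. A step from `v`
to `v + 1` adds `(T'+l)^(-v) (T'+l)⁻¹ (T - T') (T+l)^v`. The factor `l^(-v)` lost here is paid for
by the smallness `l^(R-1)` in the hypothesis, since `v ≤ R - 1`. -/
theorem norm_neg_shiftPow_mul_le [TopologicalSpace.SeparableSpace H] (hl : l ∈ Set.Ioc (0 : ℝ) 1)
    {R : ℝ} (hR : 1 ≤ R) (h : ‖d.shiftPow l (-1) * (T - T')‖ ≤ l ^ (R - 1) / 2) (k : ℕ) :
    ∀ w : ℝ, 0 ≤ w → w < k + 1 → w ≤ R → ‖d'.shiftPow l (-w) * d.shiftPow l w‖ ≤ 2 + k * 2 ^ R := by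
  have hhalf : ‖d.shiftPow l (-1) * (T - T')‖ ≤ 1 / 2 :=
    h.trans (by linarith [Real.rpow_le_one hl.1.le hl.2 (by linarith : 0 ≤ R - 1)])
  have hbase : ∀ w ∈ Set.Icc (0 : ℝ) 1, ‖d'.shiftPow l (-w) * d.shiftPow l w‖ ≤ 2 := fun w hw => by
    rw [norm_mul_swap_of_adjoint_eq (d'.adjoint_shiftPow _) (d.adjoint_shiftPow _)]
    exact d.norm_shiftPow_mul_neg_le_two d' hl.1 hhalf hw
  induction k with
  | zero =>
    intro w h0 h1 _
    simpa using hbase w ⟨h0, by simpa using h1.le⟩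
  | succ k ih =>
    intro w h0 h1 hw
    by_cases hw1 : w ≤ 1
    · exact (hbase w ⟨h0, hw1⟩).trans (le_add_of_nonneg_right (by positivity))
    obtain ⟨v, rfl⟩ : ∃ v, w = v + 1 := ⟨w - 1, by ring⟩
    have hv : 0 ≤ v := by linarith
    push_cast at h1 ⊢
    have hdiff : ‖d'.shiftPow l (-1) * (T - T')‖ ≤ l ^ (R - 1) := by
      have : d'.shiftPow l (-1) * (T - T') =
          (d'.shiftPow l (-1) * d.shiftPow l 1) * (d.shiftPow l (-1) * (T - T')) := by
        rw [mul_assoc, ← mul_assoc (d.shiftPow l 1), d.shiftPow_self_mul_neg hl.1, one_mul]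
      rw [this]
      calc _ ≤ 2 * (l ^ (R - 1) / 2) := (norm_mul_le _ _).trans <|
            mul_le_mul (d.norm_resolvent_mul_le_two d' hl.1 hhalf) h (norm_nonneg _) (by norm_num)
        _ = _ := by ring
    have hsplit : d'.shiftPow l (-(v + 1)) * d.shiftPow l (v + 1) =
        d'.shiftPow l (-v) * d.shiftPow l v +
          d'.shiftPow l (-v) * (d'.shiftPow l (-1) * (T - T')) * d.shiftPow l v := by
      rw [← d.shiftPow_one_sub d' (l := l), mul_sub, d'.shiftPow_neg_mul_self hl.1, mul_sub, mul_one,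
        sub_mul, add_sub_cancel, neg_add, ← d'.shiftPow_mul hl.1, add_comm v, ← d.shiftPow_mul hl.1]
      simp only [mul_assoc]
    rw [hsplit]
    have hl1 : l ^ (-v) * l ^ (R - 1) ≤ 1 := by
      rw [← Real.rpow_add hl.1]
      exact Real.rpow_le_one hl.1.le hl.2 (by linarith)
    have hl0 : 0 ≤ l ^ (-v) := Real.rpow_nonneg hl.1.le _
    have hprod : ‖d'.shiftPow l (-v) * (d'.shiftPow l (-1) * (T - T'))‖ ≤ 1 :=
      ((norm_mul_le _ _).trans (mul_le_mul (d'.norm_shiftPow_le_of_nonpos hl.1 (by linarith)) hdiff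
        (norm_nonneg _) hl0)).trans hl1
    have hpow : ‖d.shiftPow l v‖ ≤ 2 ^ R :=
      (d.norm_shiftPow_le_of_nonneg hl hv).trans
        (Real.rpow_le_rpow_of_exponent_le one_le_two (by linarith))
    have h2 := (norm_mul_le _ (d.shiftPow l v)).trans
      (mul_le_mul hprod hpow (norm_nonneg _) zero_le_one)
    have h3 := ih v hv (by linarith) (by linarith)
    refine (norm_add_le _ _).trans ((add_le_add h3 h2).trans (le_of_eq ?_))
    ring

/-- For `t ≤ l` the shift gives `t + l ≤ 2l` and boundedness of the residual suffices. For `t > l`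
one has `t + l ≤ 2t`, and the qualification `q` descends to `r + s` because `t^(r+s-q) ≤ l^(r+s-q)`.
-/
theorem norm_residual_le (hl : l ∈ Set.Ioc (0 : ℝ) 1) {ρ : ℝ → ℝ} {γ₀ γ q s r : ℝ}
    (hr : 0 < r) (hs : 0 ≤ s) (hq : r + s ≤ q) (hρ : ∀ t ∈ Set.Icc (0 : ℝ) 1, |ρ t| ≤ γ₀)
    (hρq : ∀ t ∈ Set.Ioc (0 : ℝ) 1, |ρ t| * t ^ q ≤ γ * l ^ q) :
    ‖d.shiftPow l s * d.op ρ * d.shiftPow l r‖ ≤ 2 ^ (r + s) * (|γ₀| + |γ|) * l ^ (r + s) := by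
  rw [shiftPow, shiftPow, d.op_comp (bddUnit_shift hl.1 s) ⟨γ₀, hρ⟩,
    d.op_comp ((bddUnit_shift hl.1 s).mul ⟨γ₀, hρ⟩) (bddUnit_shift hl.1 r)]
  refine d.norm_op_le fun t ht => ?_
  have h0 : 0 < t + l := add_pos_of_nonneg_of_pos ht.1 hl.1
  have hl0 := hl.1
  rw [mul_right_comm, ← Real.rpow_add h0, abs_mul, abs_of_nonneg (by positivity), add_comm s r]
  rcases le_or_gt t l with htl | htl
  · calc (t + l) ^ (r + s) * |ρ t| ≤ (2 * l) ^ (r + s) * |γ₀| := by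
          refine mul_le_mul ?_ ((hρ t ht).trans (le_abs_self _)) (abs_nonneg _) (by positivity)
          exact Real.rpow_le_rpow h0.le (by linarith) (by linarith)
      _ = 2 ^ (r + s) * |γ₀| * l ^ (r + s) := by
          rw [Real.mul_rpow (by norm_num) hl0.le]; ring
      _ ≤ _ := by
          gcongr
          exact le_add_of_nonneg_right (abs_nonneg _)
  · have ht0 : 0 < t := hl0.trans htl
    have h1 : |ρ t| * t ^ (r + s) ≤ |γ| * l ^ (r + s) := by
      calc |ρ t| * t ^ (r + s) = (|ρ t| * t ^ q) * t ^ (r + s - q) := by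
            rw [mul_assoc, ← Real.rpow_add ht0]; congr 2; ring
        _ ≤ (|γ| * l ^ q) * l ^ (r + s - q) := by
            have := hρq t ⟨ht0, ht.2⟩
            refine mul_le_mul (this.trans ?_) ?_ (by positivity) (by positivity)
            · gcongr; exact le_abs_self _
            · exact Real.rpow_le_rpow_of_nonpos hl0 htl.le (by linarith)
        _ = _ := by rw [mul_assoc, ← Real.rpow_add hl0]; congr 2; ring
    calc (t + l) ^ (r + s) * |ρ t| ≤ (2 * t) ^ (r + s) * |ρ t| := by
          gcongr
          linarith
      _ = 2 ^ (r + s) * (|ρ t| * t ^ (r + s)) := by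
          rw [Real.mul_rpow (by norm_num) ht0.le]; ring
      _ ≤ 2 ^ (r + s) * (|γ| * l ^ (r + s)) := by gcongr
      _ ≤ 2 ^ (r + s) * ((|γ₀| + |γ|) * l ^ (r + s)) := by
          gcongr
          exact le_add_of_nonneg_left (abs_nonneg _)
      _ = _ := by ring

theorem bddUnit_rpow_self {w : ℝ} (hw : 0 ≤ w) : BddUnit fun t => t ^ w :=
  bddUnit_rpow bddUnit_id (fun _ ht => ht.1) hw

theorem norm_rpow_le_one {w : ℝ} (hw : 0 ≤ w) : ‖d.op fun t => t ^ w‖ ≤ 1 :=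
  d.norm_op_le fun t ht => by
    rw [abs_of_nonneg (Real.rpow_nonneg ht.1 _)]
    exact Real.rpow_le_one ht.1 ht.2 hw

theorem norm_shiftPow_neg_mul_rpow_le (hl : 0 < l) {w : ℝ} (hw : 0 ≤ w) :
    ‖d.shiftPow l (-w) * d.op fun t => t ^ w‖ ≤ 1 := by
  rw [shiftPow, d.op_comp (bddUnit_shift hl _) (bddUnit_rpow_self hw)]
  refine d.norm_op_le fun t ht => ?_
  have h0 : 0 < t + l := add_pos_of_nonneg_of_pos ht.1 hl
  have ht0 := ht.1
  rw [abs_of_nonneg (by positivity), Real.rpow_neg h0.le, inv_mul_le_iff₀ (by positivity), mul_one]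
  exact Real.rpow_le_rpow ht0 (by linarith) hw

/-- The approximation error of a spectral method whose operator `T'` is a small relative
perturbation of `T`. -/
theorem norm_approx_le [TopologicalSpace.SeparableSpace H] (hl : l ∈ Set.Ioc (0 : ℝ) 1) {ρ : ℝ → ℝ}
    {γ₀ γ q s r : ℝ} (hr : 0 < r) (hs : s ∈ Set.Icc (0 : ℝ) 1) (hq : r + s ≤ q)
    (hρ : ∀ t ∈ Set.Icc (0 : ℝ) 1, |ρ t| ≤ γ₀)
    (hρq : ∀ t ∈ Set.Ioc (0 : ℝ) 1, |ρ t| * t ^ q ≤ γ * l ^ q)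
    (h : ‖d.shiftPow l (-1) * (T - T')‖ ≤ l ^ (max r 1 - 1) / 2) :
    ‖(d.op fun t => t ^ s) * d'.op ρ * d.op fun t => t ^ r‖ ≤
      2 * (2 ^ (r + s) * (|γ₀| + |γ|)) * (2 + ⌊r⌋₊ * 2 ^ max r 1) * l ^ (r + s) := by
  have hl0 := hl.1
  have hhalf : ‖d.shiftPow l (-1) * (T - T')‖ ≤ 1 / 2 :=
    h.trans (by
      linarith [Real.rpow_le_one hl.1.le hl.2 (by linarith [le_max_right r 1] : 0 ≤ max r 1 - 1)])
  -- Four trivial products of mutually inverse powers are inserted, so that the residual is met only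
  -- by powers of its own operator `T'`.
  have e1 : (d.op fun t => t ^ s) * d'.op ρ * (d.op fun t => t ^ r) =
      ((d.op fun t => t ^ s) * d.shiftPow l (-s)) * (d.shiftPow l s * d'.shiftPow l (-s)) *
        (d'.shiftPow l s * d'.op ρ * d'.shiftPow l r) * (d'.shiftPow l (-r) * d.shiftPow l r) *
        (d.shiftPow l (-r) * d.op fun t => t ^ r) := by
    exact mul_mul_eq_of_mul_eq_one (d.shiftPow_neg_mul_self hl0 s) (d'.shiftPow_neg_mul_self hl0 s)
      (d'.shiftPow_self_mul_neg hl0 r) (d.shiftPow_self_mul_neg hl0 r) _ _ _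
  have b1 : ‖(d.op fun t => t ^ s) * d.shiftPow l (-s)‖ ≤ 1 := by
    rw [norm_mul_swap_of_adjoint_eq (d.adjoint_op _) (d.adjoint_shiftPow _)]
    exact d.norm_shiftPow_neg_mul_rpow_le hl0 hs.1
  have b2 := d.norm_shiftPow_mul_neg_le_two d' hl0 hhalf hs
  have b3 := d'.norm_residual_le hl hr hs.1 hq hρ hρq
  have b4 := d.norm_neg_shiftPow_mul_le d' hl (le_max_right r 1) h ⌊r⌋₊ r hr.le
    (Nat.lt_floor_add_one r) (le_max_left r 1)
  have b5 := d.norm_shiftPow_neg_mul_rpow_le hl0 hr.le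
  rw [e1]
  calc _ ≤ 1 * 2 * (2 ^ (r + s) * (|γ₀| + |γ|) * l ^ (r + s)) * (2 + ⌊r⌋₊ * 2 ^ max r 1) * 1 := by
        refine (norm_mul_le _ _).trans (mul_le_mul ?_ b5 (norm_nonneg _) (by positivity))
        refine (norm_mul_le _ _).trans (mul_le_mul ?_ b4 (norm_nonneg _) (by positivity))
        refine (norm_mul_le _ _).trans (mul_le_mul ?_ b3 (norm_nonneg _) (by positivity))
        exact (norm_mul_le _ _).trans (mul_le_mul b1 b2 (norm_nonneg _) (by positivity))
    _ = _ := by ring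

/-- The fallback on the event where `T'` is not close to `T`. -/
theorem norm_approx_le_of_bound {ρ : ℝ → ℝ} {γ₀ s r : ℝ} (hr : 0 ≤ r) (hs : 0 ≤ s)
    (hρ : ∀ t ∈ Set.Icc (0 : ℝ) 1, |ρ t| ≤ γ₀) :
    ‖(d.op fun t => t ^ s) * d'.op ρ * d.op fun t => t ^ r‖ ≤ γ₀ := by
  have hγ : 0 ≤ γ₀ := (abs_nonneg _).trans (hρ 0 (by simp))
  calc _ ≤ 1 * γ₀ * 1 := by
        refine (norm_mul_le _ _).trans (mul_le_mul ?_ (d.norm_rpow_le_one hr) (norm_nonneg _)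
          (by positivity))
        exact (norm_mul_le _ _).trans (mul_le_mul (d.norm_rpow_le_one hs) (d'.norm_op_le hρ)
          (norm_nonneg _) (by positivity))
    _ = _ := by ring

end Eigenbasis

end Perturbation

/-! ### Moments of sums of independent vectors. -/

section Moments

theorem pow_mul_pow_le_add {a w : ℝ} (ha : 0 ≤ a) (hw : 0 ≤ w) (i j : ℕ) :
    a ^ i * w ^ (j + 1) ≤ a ^ (i + j) * w + w ^ (i + j + 1) := by
  rcases le_total a w with h | h
  · calc a ^ i * w ^ (j + 1) ≤ w ^ i * w ^ (j + 1) := by gcongr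
      _ = w ^ (i + j + 1) := by ring
      _ ≤ _ := le_add_of_nonneg_left (by positivity)
  · calc a ^ i * w ^ (j + 1) = a ^ i * w ^ j * w := by ring
      _ ≤ a ^ i * a ^ j * w := by gcongr
      _ = a ^ (i + j) * w := by ring
      _ ≤ _ := le_add_of_nonneg_right (by positivity)

/-- Meant for `a = ‖S‖²`, `w = ‖ξ‖²`, `z = ⟪S, ξ⟫`, where the left side is `‖S + ξ‖^(2(k+1))`. The
term linear in `z` is kept exactly, because its expectation vanishes; all others are dominated by
the two extreme monomials `a^k w` and `w^(k+1)`. -/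
theorem exists_add_pow_le (k : ℕ) : ∃ C : ℝ, 0 ≤ C ∧ ∀ a w z : ℝ, 0 ≤ a → 0 ≤ w → z ^ 2 ≤ a * w →
    (a + 2 * z + w) ^ (k + 1) ≤
      a ^ (k + 1) + 2 * (k + 1) * a ^ k * z + C * (a ^ k * w + w ^ (k + 1)) := by
  induction k with
  | zero => exact ⟨1, zero_le_one, fun a w z ha hw hz => by simp; linarith⟩
  | succ k ih =>
    obtain ⟨C, hC, h⟩ := ih
    refine ⟨1 + 7 * (k + 1) + 6 * C, by positivity, fun a w z ha hw hz => ?_⟩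
    have hz1 : |2 * z| ≤ a + w := abs_le_of_sq_le_sq (by nlinarith [sq_nonneg (a - w)]) (by linarith)
    obtain ⟨hz2, hz3⟩ := abs_le.1 hz1
    have hy : 0 ≤ a + 2 * z + w := by linarith
    have p1 : a ^ k * w ^ 2 ≤ a ^ (k + 1) * w + w ^ (k + 2) := pow_mul_pow_le_add ha hw k 1
    have p2 : a * w ^ (k + 1) ≤ a ^ (k + 1) * w + w ^ (k + 2) := by
      have := pow_mul_pow_le_add ha hw 1 k
      rwa [pow_one, add_comm 1 k] at this
    have q1 : a ^ k * z ^ 2 ≤ a ^ (k + 1) * w := by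
      calc a ^ k * z ^ 2 ≤ a ^ k * (a * w) := by gcongr
        _ = _ := by ring
    have q2 : a ^ k * w * (2 * z) ≤ a ^ k * w * (a + w) := by gcongr
    have q3 : C * (a ^ k * w + w ^ (k + 1)) * (a + 2 * z + w) ≤
        C * (a ^ k * w + w ^ (k + 1)) * (2 * a + 2 * w) := by
      refine mul_le_mul_of_nonneg_left (by linarith) (by positivity)
    have hw1 : 0 ≤ a ^ (k + 1) * w := by positivity
    have hw2 : 0 ≤ w ^ (k + 2) := by positivity
    have hk : (0 : ℝ) ≤ k + 1 := by positivity
    calc (a + 2 * z + w) ^ (k + 1 + 1) = (a + 2 * z + w) ^ (k + 1) * (a + 2 * z + w) := pow_succ _ _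
      _ ≤ (a ^ (k + 1) + 2 * (k + 1) * a ^ k * z + C * (a ^ k * w + w ^ (k + 1))) *
          (a + 2 * z + w) := by gcongr; exact h a w z ha hw hz
      _ = a ^ (k + 2) + 2 * (k + 2) * a ^ (k + 1) * z + a ^ (k + 1) * w +
          4 * ((k + 1) * (a ^ k * z ^ 2)) + (k + 1) * (a ^ k * w * (2 * z)) +
          C * (a ^ k * w + w ^ (k + 1)) * (a + 2 * z + w) := by ring
      _ ≤ a ^ (k + 2) + 2 * (k + 2) * a ^ (k + 1) * z + a ^ (k + 1) * w +
          4 * ((k + 1) * (a ^ (k + 1) * w)) + (k + 1) * (a ^ k * w * (a + w)) +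
          C * (a ^ k * w + w ^ (k + 1)) * (2 * a + 2 * w) := by gcongr
      _ = a ^ (k + 2) + 2 * (k + 2) * a ^ (k + 1) * z + (a ^ (k + 1) * w) * (1 + 5 * (k + 1) + 2 * C) +
          (k + 1 + 2 * C) * (a ^ k * w ^ 2) + 2 * C * (a * w ^ (k + 1)) + 2 * C * w ^ (k + 2) := by
        ring
      _ ≤ a ^ (k + 2) + 2 * (k + 2) * a ^ (k + 1) * z + (a ^ (k + 1) * w) * (1 + 5 * (k + 1) + 2 * C) +
          (k + 1 + 2 * C) * (a ^ (k + 1) * w + w ^ (k + 2)) +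
          2 * C * (a ^ (k + 1) * w + w ^ (k + 2)) + 2 * C * w ^ (k + 2) := by gcongr
      _ = a ^ (k + 2) + 2 * (k + 2) * a ^ (k + 1) * z +
          (1 + 6 * (k + 1) + 6 * C) * (a ^ (k + 1) * w) + (k + 1 + 6 * C) * w ^ (k + 2) := by ring
      _ ≤ a ^ (k + 2) + 2 * (k + 2) * a ^ (k + 1) * z +
          (1 + 7 * (k + 1) + 6 * C) * (a ^ (k + 1) * w) +
          (1 + 7 * (k + 1) + 6 * C) * w ^ (k + 2) := by
        have hk' : (0 : ℝ) ≤ k := by positivity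
        have e1 := mul_le_mul_of_nonneg_right
          (by linarith : 1 + 6 * ((k : ℝ) + 1) + 6 * C ≤ 1 + 7 * (k + 1) + 6 * C) hw1
        have e2 := mul_le_mul_of_nonneg_right
          (by linarith : (k : ℝ) + 1 + 6 * C ≤ 1 + 7 * (k + 1) + 6 * C) hw2
        linarith
      _ = _ := by push_cast; ring

variable {Ω : Type*} [MeasurableSpace Ω] {μ : Measure Ω} [IsProbabilityMeasure μ]
  {G : Type*} [NormedAddCommGroup G] [InnerProductSpace ℝ G] [MeasurableSpace G] [BorelSpace G]
  [SecondCountableTopology G]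

theorem integral_inner_eq_zero_of_indepFun {S ξ : Ω → G} (h : IndepFun S ξ μ) (hS : Measurable S)
    (hξ : Measurable ξ) (h0 : ∀ u : G, ∫ ω, ⟪u, ξ ω⟫_ℝ ∂μ = 0) {A L : ℝ} (hA : ∀ ω, ‖S ω‖ ≤ A)
    (hL : ∀ ω, ‖ξ ω‖ ≤ L) (k : ℕ) : ∫ ω, ‖S ω‖ ^ k * ⟪S ω, ξ ω⟫_ℝ ∂μ = 0 := by
  have hmap := (indepFun_iff_map_prod_eq_prod_map_map hS.aemeasurable hξ.aemeasurable).1 h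
  have hf : Measurable fun p : G × G => ‖p.1‖ ^ k * ⟪p.1, p.2⟫_ℝ := by fun_prop
  have hint : Integrable (fun p : G × G => ‖p.1‖ ^ k * ⟪p.1, p.2⟫_ℝ)
      ((μ.map S).prod (μ.map ξ)) := by
    rw [← hmap, integrable_map_measure hf.aestronglyMeasurable (hS.prodMk hξ).aemeasurable]
    refine Integrable.of_bound (hf.comp (hS.prodMk hξ)).aestronglyMeasurable (A ^ k * (A * L))
      (Eventually.of_forall fun ω => ?_)
    have hA0 : 0 ≤ A := (norm_nonneg _).trans (hA ω)
    simp only [Function.comp, norm_mul, norm_pow, norm_norm]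
    gcongr
    · exact hA ω
    · exact (norm_inner_le_norm _ _).trans (by gcongr; exacts [hA ω, hL ω])
  have hm : ∫ ω, ‖S ω‖ ^ k * ⟪S ω, ξ ω⟫_ℝ ∂μ =
      ∫ p : G × G, ‖p.1‖ ^ k * ⟪p.1, p.2⟫_ℝ ∂(μ.map fun ω => (S ω, ξ ω)) := by
    rw [integral_map (hS.prodMk hξ).aemeasurable hf.aestronglyMeasurable]
  rw [hm, hmap, integral_prod _ hint]
  simp only [integral_const_mul]
  have : ∀ u : G, ∫ y, ⟪u, y⟫_ℝ ∂(μ.map ξ) = 0 := fun u => by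
    rw [integral_map hξ.aemeasurable (by fun_prop), h0]
  simp [this]

/-- A Rosenthal type inequality for sums of independent bounded centred random vectors. -/
theorem exists_moment_sum_le (k : ℕ) : ∃ C : ℝ, 0 ≤ C ∧ ∀ {Ω : Type v} [MeasurableSpace Ω]
    {μ : Measure Ω} [IsProbabilityMeasure μ] {G : Type u} [NormedAddCommGroup G]
    [InnerProductSpace ℝ G] [MeasurableSpace G] [BorelSpace G] [SecondCountableTopology G]
    {ι : Type} {ξ : ι → Ω → G}, iIndepFun ξ μ → (∀ i, Measurable (ξ i)) →
    (∀ i u, ∫ ω, ⟪u, ξ i ω⟫_ℝ ∂μ = 0) → ∀ {L v : ℝ}, 0 ≤ v → (∀ i ω, ‖ξ i ω‖ ≤ L) →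
    (∀ i, ∫ ω, ‖ξ i ω‖ ^ 2 ∂μ ≤ v) → ∀ (I : Finset ι) {W : ℝ}, I.card * v + L ^ 2 ≤ W →
    ∫ ω, ‖∑ i ∈ I, ξ i ω‖ ^ (2 * k) ∂μ ≤ C * W ^ k := by
  induction k with
  | zero => exact ⟨1, zero_le_one, by intros; simp⟩
  | succ k ih =>
    obtain ⟨C, hC, h⟩ := ih
    obtain ⟨D, hD, hd⟩ := exists_add_pow_le k
    refine ⟨D * (C + 1), by positivity, ?_⟩
    intro Ω _ μ _ G _ _ _ _ _ ι ξ hind hmeas h0 L v hv hL hvar I W hW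
    classical
    have hW0 : 0 ≤ W := le_trans (by positivity) hW
    -- A sharper claim, linear in `I.card` with `W` fixed, is what an induction on `I` can carry:
    -- each new summand contributes at most `v * (D * (C + 1) * W ^ k)`, the lower moment of the
    -- partial sum being bounded by the outer induction.
    suffices hs : ∫ ω, ‖∑ i ∈ I, ξ i ω‖ ^ (2 * (k + 1)) ∂μ ≤
        I.card * v * (D * (C + 1) * W ^ k) by
      refine hs.trans ?_
      calc I.card * v * (D * (C + 1) * W ^ k) ≤ W * (D * (C + 1) * W ^ k) := by
            gcongr
            nlinarith [sq_nonneg L]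
        _ = _ := by ring
    induction I using Finset.induction_on with
    | empty => simp
    | insert i I hi IH =>
      rw [Finset.card_insert_of_notMem hi] at hW ⊢
      push_cast at hW ⊢
      have hW' : I.card * v + L ^ 2 ≤ W := by linarith
      have hk := h hind hmeas h0 hv hL hvar I hW'
      set S : Ω → G := fun ω => ∑ j ∈ I, ξ j ω with hS
      have hSm : Measurable S := Finset.measurable_fun_sum I fun j _ => hmeas j
      have hSξ : IndepFun S (ξ i) μ := by
        have := hind.indepFun_finsetSum_of_notMem hmeas hi
        convert this using 1
        ext ω
        simp [hS]
      have hSb : ∀ ω, ‖S ω‖ ≤ I.card * L := fun ω => by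
        refine (norm_sum_le _ _).trans ((Finset.sum_le_sum fun j _ => hL j ω).trans ?_)
        simp
      have hcross := integral_inner_eq_zero_of_indepFun hSξ hSm (hmeas i) (h0 i) hSb (hL i) (2 * k)
      have bint : ∀ {f : Ω → ℝ} (B : ℝ), Measurable f → (∀ ω, |f ω| ≤ B) → Integrable f μ :=
        fun B hf hB => Integrable.of_bound hf.aestronglyMeasurable B (Eventually.of_forall hB)
      have iS : ∀ m : ℕ, Integrable (fun ω => ‖S ω‖ ^ m) μ := fun m =>
        bint ((I.card * L) ^ m) (by fun_prop) fun ω => by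
          rw [abs_of_nonneg (by positivity)]
          exact pow_le_pow_left₀ (norm_nonneg _) (hSb ω) m
      have hξi := hmeas i
      have iξ : ∀ m : ℕ, Integrable (fun ω => ‖ξ i ω‖ ^ m) μ := fun m =>
        bint (L ^ m) (by fun_prop) fun ω => by
          rw [abs_of_nonneg (by positivity)]
          exact pow_le_pow_left₀ (norm_nonneg _) (hL i ω) m
      have iC : Integrable (fun ω => ‖S ω‖ ^ (2 * k) * ⟪S ω, ξ i ω⟫_ℝ) μ := by
        refine bint ((I.card * L) ^ (2 * k) * ((I.card * L) * L)) (by fun_prop) fun ω => ?_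
        have hA0 := (norm_nonneg _).trans (hSb ω)
        rw [abs_mul, abs_of_nonneg (by positivity : 0 ≤ ‖S ω‖ ^ (2 * k))]
        gcongr
        · exact hSb ω
        · exact (abs_real_inner_le_norm _ _).trans (by gcongr; exacts [hSb ω, hL i ω])
      have hprod : ∫ ω, ‖S ω‖ ^ (2 * k) * ‖ξ i ω‖ ^ 2 ∂μ =
          (∫ ω, ‖S ω‖ ^ (2 * k) ∂μ) * ∫ ω, ‖ξ i ω‖ ^ 2 ∂μ := by
        have := hSξ.comp (φ := fun s => ‖s‖ ^ (2 * k)) (ψ := fun s => ‖s‖ ^ 2) (by fun_prop)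
          (by fun_prop)
        exact this.integral_fun_mul_eq_mul_integral (by fun_prop) (by fun_prop)
      have iP : Integrable (fun ω => ‖S ω‖ ^ (2 * k) * ‖ξ i ω‖ ^ 2) μ := by
        have := hSξ.comp (φ := fun s => ‖s‖ ^ (2 * k)) (ψ := fun s => ‖s‖ ^ 2) (by fun_prop)
          (by fun_prop)
        exact this.integrable_mul (iS _) (iξ 2)
      -- All but two of the factors are bounded pointwise through `‖ξ i ω‖ ^ 2 ≤ L ^ 2 ≤ W`; the
      -- last two give the variance.
      have hhigh : ∫ ω, ‖ξ i ω‖ ^ (2 * (k + 1)) ∂μ ≤ W ^ k * v := by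
        calc ∫ ω, ‖ξ i ω‖ ^ (2 * (k + 1)) ∂μ ≤ ∫ ω, W ^ k * ‖ξ i ω‖ ^ 2 ∂μ := by
              refine integral_mono (iξ _) ((iξ 2).const_mul _) fun ω => ?_
              have : ‖ξ i ω‖ ^ 2 ≤ W := by
                have h1 : ‖ξ i ω‖ ^ 2 ≤ L ^ 2 := pow_le_pow_left₀ (norm_nonneg _) (hL i ω) 2
                have h2 : 0 ≤ (I.card : ℝ) * v := by positivity
                linarith
              calc ‖ξ i ω‖ ^ (2 * (k + 1)) = (‖ξ i ω‖ ^ 2) ^ k * ‖ξ i ω‖ ^ 2 := by ring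
                _ ≤ W ^ k * ‖ξ i ω‖ ^ 2 := by gcongr
          _ = W ^ k * ∫ ω, ‖ξ i ω‖ ^ 2 ∂μ := integral_const_mul _ _
          _ ≤ _ := by gcongr; exact hvar i
      have hpt : ∀ ω, ‖∑ j ∈ insert i I, ξ j ω‖ ^ (2 * (k + 1)) ≤
          ‖S ω‖ ^ (2 * (k + 1)) + 2 * (k + 1) * (‖S ω‖ ^ (2 * k) * ⟪S ω, ξ i ω⟫_ℝ) +
            D * (‖S ω‖ ^ (2 * k) * ‖ξ i ω‖ ^ 2 + ‖ξ i ω‖ ^ (2 * (k + 1))) := fun ω => by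
        have h1 : ⟪S ω, ξ i ω⟫_ℝ ^ 2 ≤ ‖S ω‖ ^ 2 * ‖ξ i ω‖ ^ 2 := by
          rw [← mul_pow, ← sq_abs]
          exact pow_le_pow_left₀ (abs_nonneg _) (abs_real_inner_le_norm _ _) 2
        have h2 := hd _ _ _ (sq_nonneg ‖S ω‖) (sq_nonneg ‖ξ i ω‖) h1
        rw [Finset.sum_insert hi, add_comm, pow_mul, norm_add_sq_real]
        simp only [pow_mul]
        simpa only [mul_assoc] using h2
      have i1 : Integrable (fun ω => ‖S ω‖ ^ (2 * (k + 1)) +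
          2 * (k + 1) * (‖S ω‖ ^ (2 * k) * ⟪S ω, ξ i ω⟫_ℝ)) μ := (iS _).add (iC.const_mul _)
      have i2 : Integrable (fun ω => ‖S ω‖ ^ (2 * k) * ‖ξ i ω‖ ^ 2 +
          ‖ξ i ω‖ ^ (2 * (k + 1))) μ := iP.add (iξ _)
      calc _ ≤ ∫ ω, (‖S ω‖ ^ (2 * (k + 1)) + 2 * (k + 1) * (‖S ω‖ ^ (2 * k) * ⟪S ω, ξ i ω⟫_ℝ) +
            D * (‖S ω‖ ^ (2 * k) * ‖ξ i ω‖ ^ 2 + ‖ξ i ω‖ ^ (2 * (k + 1)))) ∂μ := by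
            refine integral_mono_of_nonneg (Eventually.of_forall fun ω => by positivity) ?_
              (Eventually.of_forall hpt)
            exact i1.add (i2.const_mul _)
        _ = ∫ ω, ‖S ω‖ ^ (2 * (k + 1)) ∂μ + D * ((∫ ω, ‖S ω‖ ^ (2 * k) ∂μ) *
            (∫ ω, ‖ξ i ω‖ ^ 2 ∂μ) + ∫ ω, ‖ξ i ω‖ ^ (2 * (k + 1)) ∂μ) := by
            rw [integral_add i1 (i2.const_mul _),
              integral_add (iS _) (iC.const_mul _), integral_const_mul, hcross, integral_const_mul,
              integral_add iP (iξ _), hprod, mul_zero, add_zero]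
        _ ≤ I.card * v * (D * (C + 1) * W ^ k) + D * (C * W ^ k * v + W ^ k * v) := by
            gcongr
            · exact IH hW'
            · exact hvar i
        _ = _ := by ring

end Moments

/-! ### Consequences of polynomial eigenvalue decay. -/

section EigenvalueDecay

variable {H : Type u} [NormedAddCommGroup H] [InnerProductSpace ℝ H] [CompleteSpace H]
  {T : H →L[ℝ] H}

namespace Eigenbasis

variable (d : Eigenbasis T)

theorem eigSpace_eq_bot (d : Eigenbasis T) {μ : ℝ} (h : 1 < μ) : eigSpace T μ = ⊥ := by
  rw [eq_bot_iff]
  intro v hv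
  rw [Module.End.mem_eigenspace_iff] at hv
  rw [Submodule.mem_bot]
  refine d.basis.ext_inner fun i => ?_
  have h1 := d.inner_apply i v
  have h2 : T v = μ • v := hv
  rw [h2, inner_smul_right] at h1
  have h3 : (μ - d.val i) * ⟪d.basis i, v⟫_ℝ = 0 := by linarith
  rcases mul_eq_zero.1 h3 with h4 | h4
  · linarith [(d.val_mem i).2]
  · rw [h4, inner_zero_right]

/-- The basis vectors indexed by `F` are independent elements of the span of the eigenspaces above
`t`. The set in the supremum is bounded by 1, which must be checked since an unbounded `sSup` is 0.
-/
theorem le_eigenvalue_card (F : Finset d.ι) (hF : 1 ≤ F.card) {t : ℝ} (ht : 0 < t)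
    (h : ∀ i ∈ F, t ≤ d.val i) : t ≤ eigenvalue T F.card := by
  refine le_csSup ⟨1, ?_⟩ ⟨ht, ?_⟩
  · rintro τ ⟨_, hτ⟩
    by_contra! h1
    have hbot : (⨆ μ ∈ Set.Ici τ, eigSpace T μ : Submodule ℝ H) = ⊥ := by
      refine iSup₂_eq_bot.2 fun μ hμ => d.eigSpace_eq_bot (h1.trans_le hμ)
    rw [hbot, rank_bot] at hτ
    have : (F.card : Cardinal) = 0 := le_antisymm hτ zero_le
    rw [Nat.cast_eq_zero] at this
    omega
  · have hmem : ∀ i : F, d.basis i ∈ (⨆ μ ∈ Set.Ici t, eigSpace T μ : Submodule ℝ H) := fun i => by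
      refine Submodule.mem_iSup_of_mem (d.val i) (Submodule.mem_iSup_of_mem (h i i.2) ?_)
      rw [Module.End.mem_eigenspace_iff]
      exact d.apply_basis i
    have hli : LinearIndependent ℝ fun i : F =>
        (⟨d.basis i, hmem i⟩ : (⨆ μ ∈ Set.Ici t, eigSpace T μ : Submodule ℝ H)) := by
      refine LinearIndependent.of_comp (Submodule.subtype _) ?_
      exact d.basis.orthonormal.linearIndependent.comp _ Subtype.val_injective
    have := hli.cardinal_lift_le_rank
    simpa using this

/-- No enumeration of the eigenvalues in decreasing order is needed: the smallest among `n + 1` of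
them is at most the `(n+1)`-st largest, and removing it leaves `n`. -/
theorem sum_rpow_le {b β θ : ℝ} (hβ : 0 < β) (hθ : 0 < θ)
    (h : ∀ j : ℕ, 1 ≤ j → eigenvalue T j ≤ β / (j : ℝ) ^ b) (n : ℕ) :
    ∀ F : Finset d.ι, F.card = n →
      ∑ i ∈ F, d.val i ^ θ ≤ ∑ j ∈ Finset.range n, (β / ((j : ℝ) + 1) ^ b) ^ θ := by
  classical
  induction n with
  | zero => intro F hF; rw [Finset.card_eq_zero] at hF; simp [hF]
  | succ n ih =>
    intro F hF
    obtain ⟨i, hi, hmin⟩ := F.exists_min_image d.val (Finset.card_pos.1 (by omega))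
    rw [← Finset.sum_erase_add _ _ hi, Finset.sum_range_succ]
    refine add_le_add (ih _ (by rw [Finset.card_erase_of_mem hi]; omega)) ?_
    refine Real.rpow_le_rpow (d.val_mem i).1 ?_ hθ.le
    rcases (d.val_mem i).1.eq_or_lt with h0 | h0
    · rw [← h0]; positivity
    · have h1 := d.le_eigenvalue_card F (by omega) h0 hmin
      have h2 := h F.card (by omega)
      rw [hF] at h1 h2
      push_cast at h2
      exact h1.trans h2

end Eigenbasis

theorem summable_decay {b β θ : ℝ} (hβ : 0 < β) (hθ : 1 < b * θ) :
    Summable fun j : ℕ => (β / ((j : ℝ) + 1) ^ b) ^ θ := by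
  have h := ((summable_nat_add_iff 1).2 (Real.summable_nat_rpow_inv.2 hθ)).mul_left (β ^ θ)
  refine h.congr fun j => ?_
  push_cast
  rw [Real.div_rpow hβ.le (by positivity), ← Real.rpow_mul (by positivity), div_eq_mul_inv]

/-- Split `t = t^(1-θ) t^θ` and bound the first factor by `(t+l)^(1-θ)`. This replaces the effective
dimension by the convergent sum of `μ_j^θ`, at the cost of `θ` lying strictly above `1/b`. -/
theorem mul_shift_neg_one_sq_le {t l θ : ℝ} (ht : 0 ≤ t) (hl : 0 < l) (hθ : θ ∈ Set.Ioc (0 : ℝ) 1) :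
    ((t + l) ^ (-1 : ℝ)) ^ 2 * t ≤ l ^ (-1 - θ) * t ^ θ := by
  have h0 : 0 < t + l := by linarith
  rcases ht.eq_or_lt with rfl | ht
  · rw [mul_zero]; positivity
  calc ((t + l) ^ (-1 : ℝ)) ^ 2 * t = (t + l) ^ (-2 : ℝ) * (t ^ (1 - θ) * t ^ θ) := by
        rw [← Real.rpow_add ht, ← Real.rpow_natCast, ← Real.rpow_mul h0.le]
        norm_num
    _ ≤ (t + l) ^ (-2 : ℝ) * ((t + l) ^ (1 - θ) * t ^ θ) := by
        gcongr
        · linarith [hθ.2]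
        · linarith
    _ = (t + l) ^ (-1 - θ) * t ^ θ := by
        rw [← mul_assoc, ← Real.rpow_add h0]
        congr 2
        ring
    _ ≤ _ := by
        refine mul_le_mul_of_nonneg_right ?_ (by positivity)
        exact Real.rpow_le_rpow_of_nonpos hl (by linarith) (by linarith [hθ.1])

end EigenvalueDecay

/-! ### Population and empirical covariance operators. -/

section Covariance

variable {X : Type*} {H : Type u} [NormedAddCommGroup H] [InnerProductSpace ℝ H]
  [CompleteSpace H] [RKHS ℝ H X ℝ]

theorem inner_kerSec (f : H) (x : X) : ⟪f, kerSec H x⟫_ℝ = f x := by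
  simp [kerSec]

theorem norm_kerSec_le {κ : ℝ} (hκ : 0 < κ) (hbound : ∀ (f : H) (x : X), |f x| ≤ κ * ‖f‖) (x : X) :
    ‖kerSec H x‖ ≤ κ := by
  have h := hbound (kerSec H x) x
  rw [← inner_kerSec, real_inner_self_eq_norm_sq, abs_of_nonneg (sq_nonneg _), sq] at h
  rcases (norm_nonneg (kerSec H x)).eq_or_lt with h0 | h0
  · exact h0 ▸ hκ.le
  · exact le_of_mul_le_mul_right h h0

theorem pointOp_apply (x : X) (f : H) : pointOp H x f = f x • kerSec H x := by
  rw [pointOp, InnerProductSpace.rankOne_apply, real_inner_comm, inner_kerSec]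

theorem norm_pointOp_le {κ : ℝ} (hκ : 0 < κ) (hbound : ∀ (f : H) (x : X), |f x| ≤ κ * ‖f‖) (x : X) :
    ‖pointOp H x‖ ≤ κ ^ 2 := by
  rw [pointOp, InnerProductSpace.norm_rankOne, ← sq]
  exact pow_le_pow_left₀ (norm_nonneg _) (norm_kerSec_le hκ hbound x) 2

theorem isCompactOperator_pointOp (x : X) : IsCompactOperator (pointOp H x) := by
  have h : (pointOp H x : H → H) =
      ContinuousLinearMap.toSpanSingleton ℝ (kerSec H x) ∘ innerSL ℝ (kerSec H x) := by
    ext f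
    simp [pointOp]
  rw [h]
  have h1 : IsCompactOperator (innerSL ℝ (kerSec H x)) :=
    isCompactOperator_of_locallyCompactSpace_dom _
  exact h1.clm_comp _

variable [MeasurableSpace X] [TopologicalSpace.SeparableSpace H]

/-- The map is the pointwise limit of the partial sums `∑ e_i(x) e_i` of its expansion in a
countable Hilbert basis. -/
theorem stronglyMeasurable_kerSec (hmeas : ∀ f : H, Measurable fun x : X => f x) :
    StronglyMeasurable (kerSec H : X → H) := by
  obtain ⟨w, e, -⟩ := exists_hilbertBasis ℝ H
  have := e.orthonormal.countable
  refine stronglyMeasurable_of_tendsto (atTop : Filter (Finset w))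
    (f := fun F x => ∑ i ∈ F, (e i x) • e i) (fun F => ?_) ?_
  · refine Finset.stronglyMeasurable_fun_sum _ fun i _ => ?_
    exact (hmeas (e i)).stronglyMeasurable.smul_const _
  · rw [tendsto_pi_nhds]
    intro x
    have h := e.hasSum_repr (kerSec H x)
    simp only [e.repr_apply_apply, inner_kerSec] at h
    exact h

theorem stronglyMeasurable_pointOp (hmeas : ∀ f : H, Measurable fun x : X => f x) :
    StronglyMeasurable (pointOp H : X → H →L[ℝ] H) := by
  have h : Continuous fun v : H => InnerProductSpace.rankOne ℝ v v :=
    (InnerProductSpace.rankOne ℝ).continuous.clm_apply continuous_id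
  exact h.comp_stronglyMeasurable (stronglyMeasurable_kerSec hmeas)

theorem integrable_pointOp {κ : ℝ} (hκ : 0 < κ) (hmeas : ∀ f : H, Measurable fun x : X => f x)
    (hbound : ∀ (f : H) (x : X), |f x| ≤ κ * ‖f‖) (ν : Measure X) [IsProbabilityMeasure ν] :
    Integrable (pointOp H : X → H →L[ℝ] H) ν :=
  .of_bound (stronglyMeasurable_pointOp hmeas).aestronglyMeasurable (κ ^ 2)
    (Eventually.of_forall (norm_pointOp_le hκ hbound))

theorem inner_covOp {κ : ℝ} (hκ : 0 < κ) (hmeas : ∀ f : H, Measurable fun x : X => f x)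
    (hbound : ∀ (f : H) (x : X), |f x| ≤ κ * ‖f‖) (ν : Measure X) [IsProbabilityMeasure ν]
    (f h : H) :
    ⟪covOp H κ ν f, h⟫_ℝ = (κ ^ 2)⁻¹ * ∫ x, f x * h x ∂ν := by
  have hi := integrable_pointOp hκ hmeas hbound ν
  rw [covOp, smul_apply, real_inner_smul_left,
    ContinuousLinearMap.integral_apply hi, real_inner_comm,
    ← integral_inner (hi.apply_continuousLinearMap f)]
  simp only [pointOp_apply, inner_smul_right, inner_kerSec]

theorem nonempty_eigenbasis_covOp {κ : ℝ} (hκ : 0 < κ) (hmeas : ∀ f : H, Measurable fun x : X => f x)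
    (hbound : ∀ (f : H) (x : X), |f x| ≤ κ * ‖f‖) (ν : Measure X) [IsProbabilityMeasure ν] :
    Nonempty (Eigenbasis (covOp H κ ν)) := by
  have hi := integrable_pointOp hκ hmeas hbound ν
  refine nonempty_eigenbasis _ ?_ ?_ ?_ ?_
  -- Compact operators form a closed convex set, so the mean of rank-one operators stays in it.
  · have h : (∫ x, pointOp H x ∂ν) ∈ {A : H →L[ℝ] H | IsCompactOperator A} := by
      refine Convex.integral_mem ?_ isClosed_setOfPred_isCompactOperator
        (Eventually.of_forall isCompactOperator_pointOp) hi
      exact (compactOperator (RingHom.id ℝ) H H).convex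
    exact IsCompactOperator.smul h _
  · intro f h
    change ⟪covOp H κ ν f, h⟫_ℝ = ⟪f, covOp H κ ν h⟫_ℝ
    rw [real_inner_comm (covOp H κ ν h), inner_covOp hκ hmeas hbound, inner_covOp hκ hmeas hbound]
    simp only [mul_comm]
  · intro f
    rw [inner_covOp hκ hmeas hbound]
    have : 0 ≤ ∫ x, f x * f x ∂ν := integral_nonneg fun x => mul_self_nonneg _
    positivity
  · rw [covOp, norm_smul, Real.norm_of_nonneg (by positivity), inv_mul_le_iff₀ (by positivity), mul_one]
    have := norm_integral_le_of_norm_le_const (μ := ν)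
      (Eventually.of_forall (norm_pointOp_le (H := H) hκ hbound))
    simpa using this

theorem inner_empCovOp (κ : ℝ) {ι : Type*} (x : ι → X) (I : Finset ι) (f h : H) :
    ⟪empCovOp H κ x I f, h⟫_ℝ = (κ ^ 2)⁻¹ * ((I.card : ℝ)⁻¹ * ∑ i ∈ I, f (x i) * h (x i)) := by
  simp only [empCovOp, smul_apply, real_inner_smul_left,
    sum_apply, sum_inner, pointOp_apply]
  simp only [real_inner_comm h, inner_kerSec]

theorem nonempty_eigenbasis_empCovOp {κ : ℝ} (hκ : 0 < κ)
    (hbound : ∀ (f : H) (x : X), |f x| ≤ κ * ‖f‖) {ι : Type*} (x : ι → X) (I : Finset ι) :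
    Nonempty (Eigenbasis (empCovOp H κ x I)) := by
  refine nonempty_eigenbasis _ ?_ ?_ ?_ ?_
  · have h : (∑ i ∈ I, pointOp H (x i)) ∈ compactOperator (RingHom.id ℝ) H H :=
      Submodule.sum_mem _ fun i _ => isCompactOperator_pointOp _
    exact Submodule.smul_mem _ _ (Submodule.smul_mem _ _ h)
  · intro f h
    change ⟪empCovOp H κ x I f, h⟫_ℝ = ⟪f, empCovOp H κ x I h⟫_ℝ
    rw [real_inner_comm (empCovOp H κ x I h), inner_empCovOp κ, inner_empCovOp κ]
    simp only [mul_comm]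
  · intro f
    rw [inner_empCovOp κ]
    have : 0 ≤ ∑ i ∈ I, f (x i) * f (x i) := Finset.sum_nonneg fun i _ => mul_self_nonneg _
    positivity
  · rw [empCovOp, norm_smul, Real.norm_of_nonneg (by positivity), inv_mul_le_iff₀ (by positivity),
      mul_one, norm_smul, Real.norm_of_nonneg (by positivity)]
    have h1 : ‖∑ i ∈ I, pointOp H (x i)‖ ≤ I.card * κ ^ 2 := by
      refine (norm_sum_le _ _).trans
        ((Finset.sum_le_sum fun i _ => norm_pointOp_le hκ hbound (x i)).trans ?_)
      simp
    calc _ ≤ (I.card : ℝ)⁻¹ * (I.card * κ ^ 2) := by gcongr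
      _ = ((I.card : ℝ)⁻¹ * I.card) * κ ^ 2 := by ring
      _ ≤ 1 * κ ^ 2 := by gcongr; exact inv_mul_le_one
      _ = _ := one_mul _

/-- By Parseval in the eigenbasis and `∫ e_i² dν = κ² μ_i`, the integral is `κ² ∑ μ_i / (μ_i + l)²`.
-/
theorem lintegral_norm_resolvent_kerSec_le {κ : ℝ} (hκ : 0 < κ) (hmeas : ∀ f : H, Measurable fun x : X => f x)
    (hbound : ∀ (f : H) (x : X), |f x| ≤ κ * ‖f‖) (ν : Measure X) [IsProbabilityMeasure ν]
    {b β θ l : ℝ} (hβ : 0 < β) (hθ : θ ∈ Set.Ioc (0 : ℝ) 1)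
    (hbθ : 1 < b * θ) (hl : 0 < l) (d : Eigenbasis (covOp H κ ν))
    (h : ∀ j : ℕ, 1 ≤ j → eigenvalue (covOp H κ ν) j ≤ β / (j : ℝ) ^ b) :
    ∫⁻ x, ENNReal.ofReal (‖d.shiftPow l (-1) (kerSec H x)‖ ^ 2) ∂ν ≤
      ENNReal.ofReal (κ ^ 2 * l ^ (-1 - θ) * ∑' j : ℕ, (β / ((j : ℝ) + 1) ^ b) ^ θ) := by
  have := d.basis.orthonormal.countable
  have h1 : ∀ x, ENNReal.ofReal (‖d.shiftPow l (-1) (kerSec H x)‖ ^ 2) =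
      ∑' i, ENNReal.ofReal (((d.val i + l) ^ (-1 : ℝ)) ^ 2) *
        ENNReal.ofReal (d.basis i x * d.basis i x) := fun x => by
    have hs := d.hasSum_op_sq (Eigenbasis.bddUnit_shift hl (-1)) (kerSec H x)
    rw [Eigenbasis.shiftPow, ← hs.tsum_eq,
      ENNReal.ofReal_tsum_of_nonneg (fun i => by positivity) hs.summable]
    congr 1
    ext i
    rw [ENNReal.ofReal_mul (by positivity), inner_kerSec, sq (d.basis i x)]
  have hm : ∀ i, Measurable fun x => d.basis i x := fun i => hmeas _
  simp only [h1]
  rw [lintegral_tsum fun i => by fun_prop]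
  have h2 : ∀ i, ∫⁻ x, ENNReal.ofReal (((d.val i + l) ^ (-1 : ℝ)) ^ 2) *
        ENNReal.ofReal (d.basis i x * d.basis i x) ∂ν ≤
      ENNReal.ofReal (κ ^ 2 * l ^ (-1 - θ) * d.val i ^ θ) := fun i => by
    have hi : Integrable (fun x => d.basis i x * d.basis i x) ν :=
      .of_bound (by fun_prop) (κ * κ) (Eventually.of_forall fun x => by
        have := hbound (d.basis i) x
        rw [d.basis.orthonormal.1, mul_one] at this
        rw [norm_mul]
        exact mul_le_mul this this (abs_nonneg _) hκ.le)
    have hint : ∫ x, d.basis i x * d.basis i x ∂ν = κ ^ 2 * d.val i := by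
      have := inner_covOp hκ hmeas hbound ν (d.basis i) (d.basis i)
      rw [d.apply_basis, real_inner_smul_left, real_inner_self_eq_norm_sq, d.basis.orthonormal.1] at this
      rw [eq_inv_mul_iff_mul_eq₀ (by positivity)] at this
      linarith
    rw [lintegral_const_mul _ (by fun_prop), ← ofReal_integral_eq_lintegral_ofReal hi
      (Eventually.of_forall fun x => mul_self_nonneg _), hint, ← ENNReal.ofReal_mul (by positivity)]
    refine ENNReal.ofReal_le_ofReal ?_
    have := mul_shift_neg_one_sq_le (d.val_mem i).1 hl hθ
    calc _ = κ ^ 2 * (((d.val i + l) ^ (-1 : ℝ)) ^ 2 * d.val i) := by ring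
      _ ≤ κ ^ 2 * (l ^ (-1 - θ) * d.val i ^ θ) := by gcongr
      _ = _ := by ring
  refine (ENNReal.tsum_le_tsum h2).trans ?_
  rw [ENNReal.tsum_eq_iSup_sum]
  refine iSup_le fun F => ?_
  have hnn : ∀ i, 0 ≤ d.val i ^ θ := fun i => Real.rpow_nonneg (d.val_mem i).1 _
  rw [← ENNReal.ofReal_sum_of_nonneg fun i _ => mul_nonneg (by positivity) (hnn i), ← Finset.mul_sum]
  refine ENNReal.ofReal_le_ofReal (mul_le_mul_of_nonneg_left ?_ (by positivity))
  refine (d.sum_rpow_le hβ hθ.1 h _ F rfl).trans ?_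
  exact (summable_decay hβ hbθ).sum_le_tsum _ fun j _ => by positivity

end Covariance

theorem _root_.MeasureTheory.MeasurePreserving.integral_comp_of_aestronglyMeasurable {α β : Type*}
    [MeasurableSpace α] [MeasurableSpace β] {μ : Measure α} {ν : Measure β} {f : α → β}
    (h : MeasurePreserving f μ ν) {g : β → ℝ} (hg : AEStronglyMeasurable g ν) :
    ∫ a, g (f a) ∂μ = ∫ y, g y ∂ν := by
  rw [← h.map_eq] at hg ⊢
  exact (integral_map h.measurable.aemeasurable hg).symm

/-! ### The tensor square as a space of Hilbert–Schmidt operators. -/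

section TensorSpace

variable {H : Type u} [NormedAddCommGroup H] [InnerProductSpace ℝ H]

variable (H) in
/-- The Hilbert space tensor square of `H`, a model of the Hilbert–Schmidt operators. -/
abbrev TensorSquare : Type u := UniformSpace.Completion (H ⊗[ℝ] H)

instance : MeasurableSpace (TensorSquare H) := borel _

instance : BorelSpace (TensorSquare H) := ⟨rfl⟩

/-- The elementary tensor `v ⊗ w`. -/
def elemTensor (v w : H) : TensorSquare H := ((v ⊗ₜ[ℝ] w : H ⊗[ℝ] H) : TensorSquare H)

theorem inner_elemTensor (v w v' w' : H) :
    ⟪elemTensor v w, elemTensor v' w'⟫_ℝ = ⟪v, v'⟫_ℝ * ⟪w, w'⟫_ℝ := by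
  rw [elemTensor, elemTensor, UniformSpace.Completion.inner_coe, TensorProduct.inner_tmul]

theorem norm_elemTensor (v w : H) : ‖elemTensor v w‖ = ‖v‖ * ‖w‖ := by
  rw [elemTensor, UniformSpace.Completion.norm_coe, TensorProduct.norm_tmul]

theorem continuous_elemTensor : Continuous fun p : H × H => elemTensor p.1 p.2 :=
  (UniformSpace.Completion.continuous_coe _).comp TensorProduct.continuous_tmul

instance [TopologicalSpace.SeparableSpace H] : TopologicalSpace.SeparableSpace (H ⊗[ℝ] H) := by
  rw [← TopologicalSpace.isSeparable_univ_iff]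
  have h : TopologicalSpace.IsSeparable (Set.range fun p : H × H => p.1 ⊗ₜ[ℝ] p.2) :=
    TopologicalSpace.isSeparable_range TensorProduct.continuous_tmul
  have h2 := h.span (R := ℝ)
  have h3 : Submodule.span ℝ (Set.range fun p : H × H => p.1 ⊗ₜ[ℝ] p.2) = ⊤ := by
    rw [← TensorProduct.span_tmul_eq_top]
    congr 1
    ext t
    simp
  rw [h3] at h2
  exact h2

instance [TopologicalSpace.SeparableSpace H] : SecondCountableTopology (TensorSquare H) :=
  UniformSpace.secondCountable_of_separable _

end TensorSpace

/-! ### Deviation of the block covariances. -/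

section Concentration

variable {X : Type v} {H : Type u} [NormedAddCommGroup H] [InnerProductSpace ℝ H]
  [CompleteSpace H] [RKHS ℝ H X ℝ] [MeasurableSpace X] [TopologicalSpace.SeparableSpace H]

/-- The tensor that represents `κ⁻² A K_x ⊗ K_x^*`. -/
def featTensor (κ : ℝ) (A : H →L[ℝ] H) (x : X) : TensorSquare H :=
  (κ ^ 2)⁻¹ • elemTensor (kerSec H x) (A (kerSec H x))

/-- The centred tensor that represents `κ⁻² A K_x ⊗ K_x^* - A T`. -/
def centTensor (κ : ℝ) (A : H →L[ℝ] H) (ν : Measure X) (x : X) : TensorSquare H :=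
  featTensor κ A x - ∫ y, featTensor κ A y ∂ν

variable {κ : ℝ} {A : H →L[ℝ] H} {ν : Measure X} [IsProbabilityMeasure ν]

theorem stronglyMeasurable_featTensor (hmeas : ∀ f : H, Measurable fun x : X => f x) :
    StronglyMeasurable (featTensor κ A : X → TensorSquare H) := by
  have h := stronglyMeasurable_kerSec (X := X) hmeas
  have h2 : Continuous fun v : H => elemTensor v (A v) :=
    continuous_elemTensor.comp (continuous_id.prodMk A.continuous)
  exact (h2.comp_stronglyMeasurable h).const_smul ((κ ^ 2)⁻¹ : ℝ)

theorem norm_featTensor_le (hκ : 0 < κ) (hbound : ∀ (f : H) (x : X), |f x| ≤ κ * ‖f‖) (x : X) :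
    ‖featTensor κ A x‖ ≤ κ⁻¹ * ‖A (kerSec H x)‖ := by
  rw [featTensor, norm_smul, norm_elemTensor, Real.norm_of_nonneg (by positivity)]
  calc _ ≤ (κ ^ 2)⁻¹ * (κ * ‖A (kerSec H x)‖) := by
        gcongr; exact norm_kerSec_le hκ hbound x
    _ = _ := by field_simp

theorem norm_featTensor_le_norm (hκ : 0 < κ) (hbound : ∀ (f : H) (x : X), |f x| ≤ κ * ‖f‖) (x : X) :
    ‖featTensor κ A x‖ ≤ ‖A‖ := by
  refine (norm_featTensor_le hκ hbound x).trans ?_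
  calc _ ≤ κ⁻¹ * (‖A‖ * κ) := by
        gcongr
        exact (A.le_opNorm _).trans (by gcongr; exact norm_kerSec_le hκ hbound x)
    _ = _ := by field_simp

theorem integrable_featTensor (hκ : 0 < κ) (hmeas : ∀ f : H, Measurable fun x : X => f x)
    (hbound : ∀ (f : H) (x : X), |f x| ≤ κ * ‖f‖) : Integrable (featTensor κ A) ν :=
  .of_bound (stronglyMeasurable_featTensor hmeas).aestronglyMeasurable ‖A‖
    (Eventually.of_forall (norm_featTensor_le_norm hκ hbound))

theorem measurable_centTensor (hmeas : ∀ f : H, Measurable fun x : X => f x) :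
    Measurable (centTensor κ A ν) :=
  (stronglyMeasurable_featTensor hmeas).measurable.sub_const _

theorem norm_centTensor_le (hκ : 0 < κ) (hbound : ∀ (f : H) (x : X), |f x| ≤ κ * ‖f‖) (x : X) :
    ‖centTensor κ A ν x‖ ≤ 2 * ‖A‖ := by
  have h := norm_integral_le_of_norm_le_const (μ := ν)
    (Eventually.of_forall (norm_featTensor_le_norm (A := A) hκ hbound))
  rw [probReal_univ, mul_one] at h
  have := norm_sub_le (featTensor κ A x) (∫ y, featTensor κ A y ∂ν)
  have := norm_featTensor_le_norm (A := A) hκ hbound x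
  rw [centTensor]
  linarith

theorem integral_inner_centTensor (hκ : 0 < κ) (hmeas : ∀ f : H, Measurable fun x : X => f x)
    (hbound : ∀ (f : H) (x : X), |f x| ≤ κ * ‖f‖) (w : TensorSquare H) :
    ∫ x, ⟪w, centTensor κ A ν x⟫_ℝ ∂ν = 0 := by
  have hi := integrable_featTensor (A := A) (ν := ν) hκ hmeas hbound
  have hc : Integrable (centTensor κ A ν) ν := hi.sub (integrable_const _)
  rw [integral_inner hc]
  simp only [centTensor]
  rw [integral_sub hi (integrable_const _)]
  simp

theorem integral_norm_centTensor_sq_le (hκ : 0 < κ) (hmeas : ∀ f : H, Measurable fun x : X => f x)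
    (hbound : ∀ (f : H) (x : X), |f x| ≤ κ * ‖f‖) {V : ℝ} (hV : 0 ≤ V)
    (h : ∫⁻ x, ENNReal.ofReal (‖A (kerSec H x)‖ ^ 2) ∂ν ≤ ENNReal.ofReal (κ ^ 2 * V)) :
    ∫ x, ‖centTensor κ A ν x‖ ^ 2 ∂ν ≤ V := by
  have hi := integrable_featTensor (A := A) (ν := ν) hκ hmeas hbound
  have hi2 : Integrable (fun x => ‖featTensor κ A x‖ ^ 2) ν :=
    .of_bound ((stronglyMeasurable_featTensor hmeas).norm.pow 2).aestronglyMeasurable (‖A‖ ^ 2)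
      (Eventually.of_forall fun x => by
        rw [norm_pow, norm_norm]
        exact pow_le_pow_left₀ (norm_nonneg _) (norm_featTensor_le_norm hκ hbound x) 2)
  set m := ∫ y, featTensor κ A y ∂ν with hm
  have h1 : ∫ x, ‖centTensor κ A ν x‖ ^ 2 ∂ν = ∫ x, ‖featTensor κ A x‖ ^ 2 ∂ν - ‖m‖ ^ 2 := by
    have he : ∀ x, ‖centTensor κ A ν x‖ ^ 2 =
        ‖featTensor κ A x‖ ^ 2 - 2 * ⟪m, featTensor κ A x⟫_ℝ + ‖m‖ ^ 2 := fun x => by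
      rw [centTensor, norm_sub_sq_real, real_inner_comm]
    have hin : Integrable (fun x => 2 * ⟪m, featTensor κ A x⟫_ℝ) ν :=
      (hi.const_inner m).const_mul 2
    have hs : Integrable (fun x => ‖featTensor κ A x‖ ^ 2 - 2 * ⟪m, featTensor κ A x⟫_ℝ) ν :=
      hi2.sub hin
    simp only [he]
    rw [integral_add hs (integrable_const _), integral_sub hi2 hin, integral_const_mul,
      integral_inner hi, ← hm, real_inner_self_eq_norm_sq]
    simp
    ring
  have h2 : ∫ x, ‖featTensor κ A x‖ ^ 2 ∂ν ≤ V := by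
    rw [integral_eq_lintegral_of_nonneg_ae (Eventually.of_forall fun x => sq_nonneg _)
      hi2.aestronglyMeasurable]
    refine ENNReal.toReal_le_of_le_ofReal hV ?_
    calc _ ≤ ∫⁻ x, ENNReal.ofReal ((κ ^ 2)⁻¹) * ENNReal.ofReal (‖A (kerSec H x)‖ ^ 2) ∂ν := by
          refine lintegral_mono fun x => ?_
          rw [← ENNReal.ofReal_mul (by positivity)]
          refine ENNReal.ofReal_le_ofReal ?_
          rw [← inv_pow, ← mul_pow]
          exact pow_le_pow_left₀ (norm_nonneg _) (norm_featTensor_le hκ hbound x) 2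
      _ = ENNReal.ofReal ((κ ^ 2)⁻¹) * ∫⁻ x, ENNReal.ofReal (‖A (kerSec H x)‖ ^ 2) ∂ν :=
          lintegral_const_mul' _ _ ENNReal.ofReal_ne_top
      _ ≤ ENNReal.ofReal ((κ ^ 2)⁻¹) * ENNReal.ofReal (κ ^ 2 * V) := by gcongr
      _ = ENNReal.ofReal V := by
          rw [← ENNReal.ofReal_mul (by positivity), inv_mul_cancel_left₀ (by positivity)]
  rw [h1]
  linarith [sq_nonneg ‖m‖]

/-- The Hilbert–Schmidt norm dominates the operator norm: up to sign, the matrix coefficients of the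
operator are the inner products of the tensor with `v ⊗ w`, and Cauchy–Schwarz is applied with `w`
the image of `v`. -/
theorem norm_mul_covOp_sub_empCovOp_le (hκ : 0 < κ) (hmeas : ∀ f : H, Measurable fun x : X => f x)
    (hbound : ∀ (f : H) (x : X), |f x| ≤ κ * ‖f‖) (hA : ContinuousLinearMap.adjoint A = A)
    {ι : Type*} (x : ι → X) {I : Finset ι} (hI : I.Nonempty) :
    ‖A * (covOp H κ ν - empCovOp H κ x I)‖ ≤
      ‖(I.card : ℝ)⁻¹ • ∑ i ∈ I, centTensor κ A ν (x i)‖ := by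
  have hi := integrable_featTensor (A := A) (ν := ν) hκ hmeas hbound
  have hcard : (I.card : ℝ) ≠ 0 := by exact_mod_cast hI.card_pos.ne'
  have hfeat : ∀ (v w : H) y, ⟪elemTensor v w, featTensor κ A y⟫_ℝ = (κ ^ 2)⁻¹ * (v y * A w y) :=
    fun v w y => by
      rw [featTensor, inner_smul_right, inner_elemTensor, inner_kerSec,
        ← ContinuousLinearMap.adjoint_inner_left, hA, inner_kerSec]
  have key : ∀ v w : H, ⟪w, (A * (covOp H κ ν - empCovOp H κ x I)) v⟫_ℝ =
      -⟪elemTensor v w, (I.card : ℝ)⁻¹ • ∑ i ∈ I, centTensor κ A ν (x i)⟫_ℝ := fun v w => by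
    rw [mul_apply_eq_comp, ← ContinuousLinearMap.adjoint_inner_left, hA, sub_apply, inner_sub_right,
      real_inner_comm (covOp H κ ν v), real_inner_comm (empCovOp H κ x I v),
      inner_covOp hκ hmeas hbound, inner_empCovOp κ, inner_smul_right, inner_sum]
    simp only [centTensor, inner_sub_right, Finset.sum_sub_distrib, hfeat, Finset.sum_const,
      nsmul_eq_mul]
    rw [← integral_inner hi]
    simp only [hfeat]
    rw [integral_const_mul, mul_sub, inv_mul_cancel_left₀ hcard, ← Finset.mul_sum]
    ring
  refine ContinuousLinearMap.opNorm_le_bound _ (norm_nonneg _) fun v => ?_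
  set N := ‖(I.card : ℝ)⁻¹ • ∑ i ∈ I, centTensor κ A ν (x i)‖
  set y := (A * (covOp H κ ν - empCovOp H κ x I)) v with hy
  have h := key v y
  have h2 : ‖y‖ * ‖y‖ ≤ (N * ‖v‖) * ‖y‖ := by
    rw [← real_inner_self_eq_norm_mul_norm, hy, h, ← hy]
    refine (neg_le_abs _).trans ((abs_real_inner_le_norm _ _).trans (le_of_eq ?_))
    rw [norm_elemTensor]; ring
  rcases (norm_nonneg y).eq_or_lt with h0 | h0
  · rw [← h0]; positivity
  · exact le_of_mul_le_mul_right h2 h0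

/-- Markov's inequality for the moment of order `2k`. The `4 * L ^ 2` is the square of the bound `2
* L` on the centred tensors. -/
theorem exists_measure_centTensor_le (k : ℕ) : ∃ C : ℝ, 0 ≤ C ∧
    ∀ {κ : ℝ} {A : H →L[ℝ] H} {ρ : Measure (X × ℝ)} [IsProbabilityMeasure ρ], 0 < κ →
    (∀ f : H, Measurable fun x : X => f x) → (∀ (f : H) (x : X), |f x| ≤ κ * ‖f‖) →
    ∀ {L V η : ℝ}, ‖A‖ ≤ L → 0 ≤ V → 0 < η →
    ∫⁻ x, ENNReal.ofReal (‖A (kerSec H x)‖ ^ 2) ∂ρ.fst ≤ ENNReal.ofReal (κ ^ 2 * V) →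
    ∀ {n : ℕ} {I : Finset (Fin n)}, I.Nonempty →
    (Measure.pi fun _ : Fin n => ρ)
      {D | η < ‖(I.card : ℝ)⁻¹ • ∑ i ∈ I, centTensor κ A ρ.fst (D i).1‖} ≤
      ENNReal.ofReal (C * ((V / I.card + 4 * L ^ 2 / I.card ^ 2) / η ^ 2) ^ k) := by
  obtain ⟨C, hC, hmom⟩ := exists_moment_sum_le k
  refine ⟨C, hC, ?_⟩
  intro κ A ρ _ hκ hmeas hbound L V η hL hV hη hAV n I hI
  have hcard : (0 : ℝ) < I.card := by exact_mod_cast hI.card_pos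
  set P := Measure.pi fun _ : Fin n => ρ with hP
  have hcm := measurable_centTensor (κ := κ) (A := A) (ν := ρ.fst) hmeas
  set ξ : Fin n → (Fin n → X × ℝ) → TensorSquare H := fun i D => centTensor κ A ρ.fst (D i).1 with hξ
  have hξm : ∀ i, Measurable (ξ i) := fun i => hcm.comp (measurable_fst.comp (measurable_pi_apply i))
  have hind : iIndepFun ξ P := iIndepFun_pi (X := fun _ (z : X × ℝ) => centTensor κ A ρ.fst z.1)
    fun i => (hcm.comp measurable_fst).aemeasurable
  have htrans : ∀ (i : Fin n) {F : TensorSquare H → ℝ}, Continuous F →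
      ∫ D, F (ξ i D) ∂P = ∫ x, F (centTensor κ A ρ.fst x) ∂ρ.fst := fun i F hF => by
    have hFm : StronglyMeasurable fun x => F (centTensor κ A ρ.fst x) :=
      (hF.measurable.comp hcm).stronglyMeasurable
    have e1 : ∫ x, F (centTensor κ A ρ.fst x) ∂ρ.fst = ∫ z, F (centTensor κ A ρ.fst z.1) ∂ρ :=
      integral_map measurable_fst.aemeasurable hFm.aestronglyMeasurable
    have e2 := (measurePreserving_eval (fun _ : Fin n => ρ) i).integral_comp_of_aestronglyMeasurable
      (hFm.comp_measurable measurable_fst).aestronglyMeasurable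
    rw [e1]
    exact e2
  have hbd : ∀ i D, ‖ξ i D‖ ≤ 2 * L := fun i D =>
    (norm_centTensor_le hκ hbound _).trans (by gcongr)
  have hm := hmom hind hξm
    (fun i w => by
      rw [htrans i (F := fun z => ⟪w, z⟫_ℝ) (by fun_prop), integral_inner_centTensor hκ hmeas hbound])
    hV hbd
    (fun i => by
      rw [htrans i (F := fun z => ‖z‖ ^ 2) (by fun_prop)]
      exact integral_norm_centTensor_sq_le hκ hmeas hbound hV hAV) I le_rfl
  have hSm : Measurable fun D => ‖∑ i ∈ I, ξ i D‖ ^ (2 * k) :=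
    ((Finset.measurable_fun_sum I fun j _ => hξm j).norm).pow_const _
  have hint : Integrable (fun D => ‖∑ i ∈ I, ξ i D‖ ^ (2 * k)) P := by
    refine .of_bound hSm.aestronglyMeasurable ((I.card * (2 * L)) ^ (2 * k))
      (Eventually.of_forall fun D => ?_)
    rw [norm_pow, norm_norm]
    refine pow_le_pow_left₀ (norm_nonneg _) ((norm_sum_le _ _).trans
      ((Finset.sum_le_sum fun j _ => hbd j D).trans ?_)) _
    simp
  have hmark := mul_meas_ge_le_integral_of_nonneg (μ := P)
    (Eventually.of_forall fun D => by positivity) hint ((I.card * η) ^ (2 * k))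
  have hε : 0 < (I.card * η) ^ (2 * k) := by positivity
  have hsub : {D | η < ‖(I.card : ℝ)⁻¹ • ∑ i ∈ I, centTensor κ A ρ.fst (D i).1‖} ⊆
      {D | (I.card * η) ^ (2 * k) ≤ ‖∑ i ∈ I, ξ i D‖ ^ (2 * k)} := fun D hD => by
    rw [Set.mem_ofPred_eq, norm_smul, Real.norm_of_nonneg (by positivity), lt_inv_mul_iff₀ hcard] at hD
    exact pow_le_pow_left₀ (by positivity) hD.le _
  refine (measure_mono hsub).trans ?_
  rw [← ofReal_measureReal]
  refine ENNReal.ofReal_le_ofReal ?_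
  rw [← le_div_iff₀' hε] at hmark
  refine hmark.trans ?_
  rw [div_le_iff₀ hε]
  refine hm.trans (le_of_eq ?_)
  rw [pow_mul, mul_assoc, ← mul_pow]
  congr 2
  field_simp
  ring

end Concentration

/-! ### Exponents and asymptotics in `n`. -/

section Asymptotics

/-- The leading factor `n` stands for the union bound over the blocks, and `n^(-w)` for the
probability that the bad event may have. -/
theorem eventually_mul_pow_le {A₁ A₂ B C x₁ x₂ δ w : ℝ} {k : ℕ} (hA₁ : 0 ≤ A₁) (hA₂ : 0 ≤ A₂)
    (hB : 0 < B) (hC : 0 ≤ C) (hx₁ : x₁ ≤ -δ) (hx₂ : x₂ ≤ -δ) (hk : 1 + w < δ * k) :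
    ∀ᶠ n : ℕ in atTop,
      (n : ℝ) * (C * (A₁ * (n : ℝ) ^ x₁ + A₂ * (n : ℝ) ^ x₂) ^ k) ≤ B * (n : ℝ) ^ (-w) := by
  have hlim : Tendsto (fun n : ℕ => C * (A₁ + A₂) ^ k * (n : ℝ) ^ (-(δ * k - 1 - w))) atTop
      (𝓝 (C * (A₁ + A₂) ^ k * 0)) :=
    ((tendsto_rpow_neg_atTop (by linarith)).comp tendsto_natCast_atTop_atTop).const_mul _
  rw [mul_zero] at hlim
  filter_upwards [hlim.eventually (ge_mem_nhds hB), eventually_ge_atTop 1] with n hn hn1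
  have hn1' : (1 : ℝ) ≤ n := by exact_mod_cast hn1
  have hn0 : (0 : ℝ) < n := by linarith
  calc (n : ℝ) * (C * (A₁ * (n : ℝ) ^ x₁ + A₂ * (n : ℝ) ^ x₂) ^ k)
      ≤ (n : ℝ) * (C * (A₁ * (n : ℝ) ^ (-δ) + A₂ * (n : ℝ) ^ (-δ)) ^ k) := by gcongr
    _ = C * (A₁ + A₂) ^ k * ((n : ℝ) ^ (1 : ℝ) * ((n : ℝ) ^ (-δ)) ^ (k : ℝ)) := by
        rw [← add_mul, mul_pow, Real.rpow_natCast, Real.rpow_one]; ring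
    _ = C * (A₁ + A₂) ^ k * (n : ℝ) ^ (-(δ * k - 1 - w)) * (n : ℝ) ^ (-w) := by
        rw [← Real.rpow_mul hn0.le, ← Real.rpow_add hn0,
          mul_assoc (C * (A₁ + A₂) ^ k), ← Real.rpow_add hn0]
        congr 2
        ring
    _ ≤ B * (n : ℝ) ^ (-w) := by gcongr

/-- At `θ = 1/b` the first exponent is negative precisely under the condition on `α`, because `min r
1 = r + 1 - max r 1`. The strict gap `g` leaves room to raise `θ` above `1/b`, spending half of it.
-/
theorem exists_exponents {b r α : ℝ} (hb : 1 < b) (hr : 0 < r)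
    (hα : α < 2 * b * min r 1 / (2 * b * r + b + 1)) :
    ∃ θ ∈ Set.Ioc (0 : ℝ) 1, 1 < b * θ ∧ ∃ δ : ℝ, 0 < δ ∧
      b / (2 * b * r + b + 1) * (θ + 2 * max r 1 - 1) + (α - 1) ≤ -δ ∧
      b / (2 * b * r + b + 1) * (2 * max r 1) + 2 * (α - 1) ≤ -δ := by
  set D := 2 * b * r + b + 1 with hD
  have hD0 : 0 < D := by positivity
  set e := b / D with he
  have he0 : 0 < e := by positivity
  set R := max r 1 with hR
  have hR1 : 1 ≤ R := le_max_right _ _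
  have hmin : min r 1 = r + 1 - R := by
    have := min_add_max r 1
    linarith
  have hkey : α - 1 < -(e * (1 / b + 2 * R - 1)) := by
    have h1 : 2 * b * min r 1 / D - 1 = -(e * (1 / b + 2 * R - 1)) := by
      rw [hmin, he]
      field_simp
      rw [hD]
      ring
    linarith
  set g := -(e * (1 / b + 2 * R - 1)) - (α - 1) with hg
  have hg0 : 0 < g := by linarith
  have hb1 : 1 / b < 1 := by rw [div_lt_one (by linarith)]; exact hb
  have hb0 : 0 < 1 / b := by positivity
  refine ⟨min 1 (1 / b + g / (2 * e)), ⟨by positivity, min_le_left _ _⟩, ?_, g / 2, by positivity,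
    ?_, ?_⟩
  · have : 1 / b < min 1 (1 / b + g / (2 * e)) :=
      lt_min hb1 (lt_add_of_pos_right _ (by positivity))
    rw [div_lt_iff₀ (by linarith)] at this
    linarith
  · have h1 : e * min 1 (1 / b + g / (2 * e)) ≤ e * (1 / b + g / (2 * e)) := by
      gcongr; exact min_le_right _ _
    have h2 : e * (1 / b + g / (2 * e)) = e * (1 / b) + g / 2 := by field_simp
    nlinarith
  -- As `R ≥ 1`, the second exponent is at most twice the first one taken at `θ = 1/b`.
  · have h1 : e * (2 * R) ≤ 2 * (e * (1 / b + 2 * R - 1)) := by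
      have : 2 * R ≤ 2 * (1 / b + 2 * R - 1) := by linarith
      nlinarith
    linarith

theorem rpow_div_rpow_neg {c x : ℝ} (hc : 0 < c) (hx : 0 < x) (e w : ℝ) :
    ((c / x) ^ e) ^ (-w) = c ^ (-(e * w)) * x ^ (e * w) := by
  rw [← Real.rpow_mul (by positivity), Real.div_rpow hc.le hx.le, mul_neg, Real.rpow_neg hx.le,
    div_inv_eq_mul]

theorem deviation_bound_le {S N l R θ c x e α : ℝ} (hS : 0 ≤ S) (hc : 0 < c) (hx : 0 < x)
    (hl : l = (c / x) ^ e) (hN0 : 0 < N) (hN : N⁻¹ ≤ x ^ (α - 1)) :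
    (l ^ (-1 - θ) * S / N + 4 * (l ^ (-1 : ℝ)) ^ 2 / N ^ 2) / (l ^ (R - 1) / 2) ^ 2 ≤
      4 * S * c ^ (-(e * (θ + 2 * R - 1))) * x ^ (e * (θ + 2 * R - 1) + (α - 1)) +
        16 * c ^ (-(e * (2 * R))) * x ^ (e * (2 * R) + 2 * (α - 1)) := by
  have hl0 : 0 < l := by rw [hl]; positivity
  have e1 : l ^ (-1 - θ) * l ^ (-(2 * (R - 1))) = l ^ (-(θ + 2 * R - 1)) := by
    rw [← Real.rpow_add hl0]; congr 1; ring
  have e2 : (l ^ (-1 : ℝ)) ^ 2 * l ^ (-(2 * (R - 1))) = l ^ (-(2 * R)) := by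
    rw [← Real.rpow_natCast, ← Real.rpow_mul hl0.le, ← Real.rpow_add hl0]
    congr 1; push_cast; ring
  have e3 : (l ^ (R - 1)) ^ 2 = (l ^ (-(2 * (R - 1))))⁻¹ := by
    rw [← Real.rpow_neg hl0.le, ← Real.rpow_natCast, ← Real.rpow_mul hl0.le]
    congr 1; push_cast; ring
  have h0 : (l ^ (-1 - θ) * S / N + 4 * (l ^ (-1 : ℝ)) ^ 2 / N ^ 2) / (l ^ (R - 1) / 2) ^ 2 =
      4 * S * l ^ (-(θ + 2 * R - 1)) * N⁻¹ + 16 * l ^ (-(2 * R)) * (N⁻¹) ^ 2 := by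
    rw [← e1, ← e2, div_pow, e3]
    field_simp
    ring
  have hx2 : (x ^ (α - 1)) ^ 2 = x ^ (2 * (α - 1)) := by
    rw [← Real.rpow_natCast, ← Real.rpow_mul hx.le]
    congr 1; push_cast; ring
  rw [h0]
  calc _ ≤ 4 * S * l ^ (-(θ + 2 * R - 1)) * x ^ (α - 1) +
        16 * l ^ (-(2 * R)) * (x ^ (α - 1)) ^ 2 := by gcongr
    _ = _ := by
        rw [hx2, hl, rpow_div_rpow_neg hc hx, rpow_div_rpow_neg hc hx, Real.rpow_add hx,
          Real.rpow_add hx]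
        ring

end Asymptotics

/-! ### From operator bounds to `L^p` bounds. -/

section Approximation

variable {X : Type v} {H : Type u} [NormedAddCommGroup H] [InnerProductSpace ℝ H]
  [CompleteSpace H] [RKHS ℝ H X ℝ]

/-- The assumed bounds leave out `t = 0`, whose single value is included by hand. -/
theorem IsRegularization.bddUnit {g : ℝ → ℝ → ℝ} (hg : IsRegularization g) {l : ℝ}
    (hl : l ∈ Set.Ioc (0 : ℝ) 1) : BddUnit (g l) := by
  obtain ⟨E, hE⟩ := hg.bound
  refine ⟨max (E / l) |g l 0|, fun t ht => ?_⟩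
  rcases ht.1.eq_or_lt with rfl | h0
  · exact le_max_right _ _
  · exact (hE l hl t ⟨h0, ht.2⟩).trans (le_max_left _ _)

theorem sub_avgApprox_eq {κ : ℝ} {g : ℝ → ℝ → ℝ} {l : ℝ} (hg : BddUnit (g l)) {n m : ℕ} (hm : 0 < m)
    (c : Fin n → Fin m) (x : Fin n → X) (f : H)
    (d : ∀ j, Eigenbasis (empCovOp H κ x (block c j))) :
    f - avgApprox κ g l c x f = (m : ℝ)⁻¹ • ∑ j, (d j).op (fun t => 1 - g l t * t) f := by
  have hm0 : (m : ℝ) ≠ 0 := by positivity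
  have hj : ∀ j, (d j).op (fun t => 1 - g l t * t) f =
      f - specFun (g l) (empCovOp H κ x (block c j)) (empCovOp H κ x (block c j) f) := fun j => by
    have h1 : (d j).op (fun t => 1 - g l t * t) + (d j).op (fun t => g l t * t) = 1 := by
      have hb : BddUnit fun t => 1 - g l t * t := by
        have := (bddUnit_const 1).add ((bddUnit_const (-1)).mul (hg.mul bddUnit_id))
        simpa only [neg_mul, one_mul, ← sub_eq_add_neg] using this
      rw [(d j).op_add hb (hg.mul bddUnit_id)]
      simp only [sub_add_cancel, (d j).op_const, one_smul]
    rw [(d j).specFun_eq hg, eq_sub_iff_add_eq]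
    nth_rewrite 3 [← (d j).op_id]
    rw [← mul_apply_eq_comp, (d j).op_comp hg bddUnit_id, ← add_apply, h1]
    rfl
  simp only [hj, Finset.sum_sub_distrib, avgApprox, smul_sub]
  simp [← Nat.cast_smul_eq_nsmul ℝ, smul_smul, inv_mul_cancel₀ hm0]

theorem norm_opPow_sub_avgApprox_le {κ : ℝ} {g : ℝ → ℝ → ℝ} {l : ℝ} (hg : BddUnit (g l)) {n m : ℕ}
    (hm : 0 < m) (c : Fin n → Fin m) (x : Fin n → X) {T : H →L[ℝ] H} (d₀ : Eigenbasis T)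
    (d : ∀ j, Eigenbasis (empCovOp H κ x (block c j))) {s r R B : ℝ} (hs : 0 ≤ s) (hr : 0 ≤ r) {h : H}
    (hh : ‖h‖ ≤ R)
    (hB : ∀ j, ‖(d₀.op fun t => t ^ s) * (d j).op (fun t => 1 - g l t * t) *
      d₀.op fun t => t ^ r‖ ≤ B) :
    ‖opPow T s (opPow T r h - avgApprox κ g l c x (opPow T r h))‖ ≤ R * B := by
  have hm0 : (0 : ℝ) < m := by positivity
  rw [sub_avgApprox_eq hg hm c x _ d, opPow, opPow,
    d₀.specFun_eq (Eigenbasis.bddUnit_rpow_self hs), d₀.specFun_eq (Eigenbasis.bddUnit_rpow_self hr),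
    map_smul, map_sum, norm_smul, Real.norm_of_nonneg (by positivity), inv_mul_le_iff₀ hm0]
  have h1 : ∀ j, ‖(d₀.op fun t => t ^ s) ((d j).op (fun t => 1 - g l t * t)
      ((d₀.op fun t => t ^ r) h))‖ ≤ R * B := fun j => by
    have := ((d₀.op fun t => t ^ s) * (d j).op (fun t => 1 - g l t * t) *
      d₀.op fun t => t ^ r).le_opNorm h
    refine this.trans ?_
    rw [mul_comm]
    have hB0 := (norm_nonneg _).trans (hB j)
    exact mul_le_mul hh (hB j) (norm_nonneg _) ((norm_nonneg _).trans hh)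
  refine (norm_sum_le _ _).trans ((Finset.sum_le_sum fun j _ => h1 j).trans ?_)
  simp

/-- The norm of `F` is dominated by `a + c · 1_B`, so Minkowski is needed only for this majorant and
no measurability of `F` enters. -/
theorem eLpNorm_le_of_norm_le_of_notMem {Ω E : Type*} [MeasurableSpace Ω] [NormedAddCommGroup E]
    {P : Measure Ω} [IsProbabilityMeasure P] {F : Ω → E} {a c ε p : ℝ} (hp : 1 ≤ p) (ha : 0 ≤ a)
    (hc : 0 ≤ c) (hε : 0 ≤ ε) {B : Set Ω} (hB : MeasurableSet B)
    (hPB : P B ≤ ENNReal.ofReal (ε ^ p)) (h1 : ∀ ω, ω ∉ B → ‖F ω‖ ≤ a) (h2 : ∀ ω, ‖F ω‖ ≤ c) :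
    eLpNorm F (ENNReal.ofReal p) P ≤ ENNReal.ofReal (a + c * ε) := by
  have hp0 : 0 < p := by linarith
  have hpr : (ENNReal.ofReal p).toReal = p := ENNReal.toReal_ofReal hp0.le
  have hp1 : ENNReal.ofReal p ≠ 0 := by simpa using hp0
  calc eLpNorm F (ENNReal.ofReal p) P
      ≤ eLpNorm ((fun _ => a) + B.indicator fun _ => c) (ENNReal.ofReal p) P := by
        refine eLpNorm_mono_real fun ω => ?_
        by_cases hω : ω ∈ B
        · simp only [Pi.add_apply, Set.indicator_of_mem hω]
          linarith [h2 ω]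
        · simp only [Pi.add_apply, Set.indicator_of_notMem hω, add_zero]
          exact h1 ω hω
    _ ≤ eLpNorm (fun _ : Ω => a) (ENNReal.ofReal p) P +
        eLpNorm (B.indicator fun _ => c) (ENNReal.ofReal p) P :=
        eLpNorm_add_le aestronglyMeasurable_const
          (aestronglyMeasurable_const.indicator hB) (by simpa using hp)
    _ ≤ ENNReal.ofReal a + ENNReal.ofReal c * ENNReal.ofReal ε := by
        rw [eLpNorm_const _ hp1 (IsProbabilityMeasure.ne_zero P),
          eLpNorm_indicator_const hB hp1 ENNReal.ofReal_ne_top, measure_univ, ENNReal.one_rpow, mul_one,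
          hpr, Real.enorm_of_nonneg ha, Real.enorm_of_nonneg hc]
        gcongr
        calc P B ^ (1 / p) ≤ ENNReal.ofReal (ε ^ p) ^ (1 / p) :=
              ENNReal.rpow_le_rpow hPB (by positivity)
          _ = ENNReal.ofReal ε := by
            rw [ENNReal.ofReal_rpow_of_nonneg (by positivity) (by positivity), ← Real.rpow_mul hε,
              mul_one_div_cancel hp0.ne', Real.rpow_one]
    _ = _ := by rw [ENNReal.ofReal_add ha (by positivity), ENNReal.ofReal_mul hc]

end Approximation

/-! ### The moment bound and the theorem. -/

section Main

variable {X : Type v} {H : Type u} [NormedAddCommGroup H] [InnerProductSpace ℝ H]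
  [CompleteSpace H] [RKHS ℝ H X ℝ] [MeasurableSpace X] [TopologicalSpace.SeparableSpace H]

/-- The moment bound for the approximation error, given that large deviations of the block
covariances are sufficiently unlikely. -/
theorem eLpNorm_approx_le {κ : ℝ} (hκ : 0 < κ) (hmeas : ∀ f : H, Measurable fun x : X => f x)
    (hbound : ∀ (f : H) (x : X), |f x| ≤ κ * ‖f‖) {b β r s p q γ₀ γ l θ ε : ℝ} (hβ : 0 < β)
    (hr : 0 < r) (hs : s ∈ Set.Icc (0 : ℝ) 1) (hp : 1 ≤ p) {g : ℝ → ℝ → ℝ}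
    (hl : l ∈ Set.Ioc (0 : ℝ) 1) (hg : BddUnit (g l)) (hq : r + s ≤ q)
    (hg₀ : ∀ t ∈ Set.Icc (0 : ℝ) 1, |1 - g l t * t| ≤ γ₀)
    (hgq : ∀ t ∈ Set.Ioc (0 : ℝ) 1, |1 - g l t * t| * t ^ q ≤ γ * l ^ q)
    (hθ : θ ∈ Set.Ioc (0 : ℝ) 1) (hbθ : 1 < b * θ) {k : ℕ} {C : ℝ} (hC : 0 ≤ C)
    (hdev : ∀ {A : H →L[ℝ] H} {ρ : Measure (X × ℝ)} [IsProbabilityMeasure ρ]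
      {L V η : ℝ}, ‖A‖ ≤ L → 0 ≤ V → 0 < η →
      ∫⁻ x, ENNReal.ofReal (‖A (kerSec H x)‖ ^ 2) ∂ρ.fst ≤ ENNReal.ofReal (κ ^ 2 * V) →
      ∀ {n : ℕ} {I : Finset (Fin n)}, I.Nonempty →
      (Measure.pi fun _ : Fin n => ρ)
        {D | η < ‖(I.card : ℝ)⁻¹ • ∑ i ∈ I, centTensor κ A ρ.fst (D i).1‖} ≤
        ENNReal.ofReal (C * ((V / I.card + 4 * L ^ 2 / I.card ^ 2) / η ^ 2) ^ k))
    {n m : ℕ} (hn : 0 < n) {c : Fin n → Fin m} (hc : IsEqualPartition c) {Q : ℝ} (hε : 0 ≤ ε)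
    (hQ : ∀ N : ℝ, 0 < N → m * N = n →
      (l ^ (-1 - θ) * (∑' j : ℕ, (β / ((j : ℝ) + 1) ^ b) ^ θ) / N +
        4 * (l ^ (-1 : ℝ)) ^ 2 / N ^ 2) / (l ^ (max r 1 - 1) / 2) ^ 2 ≤ Q)
    (hQε : n * (C * Q ^ k) ≤ ε ^ p)
    {ρ : Measure (X × ℝ)} {f : H} {σ R : ℝ} (hR : 0 < R) (hρ : InModel κ b β r σ R ρ f) :
    eLpNorm (fun D : Fin n → X × ℝ => opPow (covOp H κ ρ.fst) s
        (f - avgApprox κ g l c (fun i => (D i).1) f)) (ENNReal.ofReal p)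
        (Measure.pi fun _ : Fin n => ρ) ≤
      ENNReal.ofReal (R * (2 * (2 ^ (r + s) * (|γ₀| + |γ|)) * (2 + ⌊r⌋₊ * 2 ^ max r 1) *
        l ^ (r + s)) + R * γ₀ * ε) := by
  obtain ⟨⟨hprob, hdecay⟩, ⟨h, hh, rfl⟩, -⟩ := hρ
  have : IsProbabilityMeasure ρ := ⟨by rw [← Measure.fst_univ]; exact measure_univ⟩
  have hl0 := hl.1
  obtain ⟨d₀⟩ := nonempty_eigenbasis_covOp hκ hmeas hbound ρ.fst
  have hγ₀ : 0 ≤ γ₀ := (abs_nonneg _).trans (hg₀ 0 (by simp))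
  set S := ∑' j : ℕ, (β / ((j : ℝ) + 1) ^ b) ^ θ with hS
  have hS0 : 0 ≤ S := tsum_nonneg fun j => by positivity
  have hcard : ∀ j, (m : ℝ) * (block c j).card = n := fun j => by exact_mod_cast hc j
  have hne : ∀ j, (block c j).Nonempty := fun j => by
    rw [← Finset.card_pos]
    refine Nat.pos_of_ne_zero fun h0 => ?_
    have := hc j
    rw [h0] at this
    omega
  have hm : 0 < m := Fin.pos (c ⟨0, hn⟩)
  have hmn : m ≤ n := by
    have := Nat.mul_le_mul_left m (hne ⟨0, hm⟩).card_pos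
    rw [hc] at this
    simpa using this
  set A := d₀.shiftPow l (-1) with hA
  set η := l ^ (max r 1 - 1) / 2 with hη
  have hη0 : 0 < η := by positivity
  -- The bad event is stated for the tensor norm rather than the operator norm; its measurability is
  -- then immediate.
  set E : Fin m → Set (Fin n → X × ℝ) := fun j =>
    {D | η < ‖((block c j).card : ℝ)⁻¹ • ∑ i ∈ block c j, centTensor κ A ρ.fst (D i).1‖} with hE
  have hEm : ∀ j, MeasurableSet (E j) := fun j => by
    have h1 : Measurable fun D : Fin n → X × ℝ => ∑ i ∈ block c j, centTensor κ A ρ.fst (D i).1 :=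
      Finset.measurable_fun_sum _ fun i _ =>
        (measurable_centTensor hmeas).comp (measurable_fst.comp (measurable_pi_apply i))
    have h2 : Measurable fun D : Fin n → X × ℝ =>
        ((block c j).card : ℝ)⁻¹ • ∑ i ∈ block c j, centTensor κ A ρ.fst (D i).1 :=
      h1.const_smul (((block c j).card : ℝ)⁻¹)
    exact measurableSet_lt measurable_const h2.norm
  have hEP : ∀ j, (Measure.pi fun _ : Fin n => ρ) (E j) ≤ ENNReal.ofReal (C * Q ^ k) := fun j => by
    have hN : (0 : ℝ) < (block c j).card := by exact_mod_cast (hne j).card_pos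
    refine (hdev (L := l ^ (-1 : ℝ)) (V := l ^ (-1 - θ) * S)
      (d₀.norm_shiftPow_le_of_nonpos hl0 (by norm_num)) (by positivity) hη0 ?_ (hne j)).trans ?_
    · rw [← mul_assoc]
      exact lintegral_norm_resolvent_kerSec_le hκ hmeas hbound _ hβ hθ hbθ hl0 d₀ hdecay
    · refine ENNReal.ofReal_le_ofReal (mul_le_mul_of_nonneg_left ?_ hC)
      exact pow_le_pow_left₀ (by positivity) (hQ _ hN (hcard j)) k
  have hQk : 0 ≤ C * Q ^ k := by
    have hN : (0 : ℝ) < (block c ⟨0, hm⟩).card := by exact_mod_cast (hne ⟨0, hm⟩).card_pos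
    have : 0 ≤ Q := le_trans (by positivity) (hQ _ hN (hcard ⟨0, hm⟩))
    positivity
  refine eLpNorm_le_of_norm_le_of_notMem hp (by positivity) (by positivity) hε
    (MeasurableSet.iUnion hEm) ?_ (fun D hD => ?_) (fun D => ?_)
  · refine (measure_iUnion_fintype_le _ _).trans ((Finset.sum_le_sum fun j _ => hEP j).trans ?_)
    rw [Finset.sum_const, nsmul_eq_mul, Finset.card_univ, Fintype.card_fin,
      ← ENNReal.ofReal_natCast, ← ENNReal.ofReal_mul (by positivity)]
    refine ENNReal.ofReal_le_ofReal (le_trans ?_ hQε)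
    gcongr
  · have d := fun j => Classical.choice
      (nonempty_eigenbasis_empCovOp (H := H) hκ hbound (fun i => (D i).1) (block c j))
    refine norm_opPow_sub_avgApprox_le hg hm c _ d₀ d hs.1 hr.le hh fun j => ?_
    refine d₀.norm_approx_le (d j) hl hr hs hq hg₀ hgq ?_
    refine (norm_mul_covOp_sub_empCovOp_le hκ hmeas hbound (d₀.adjoint_shiftPow _) _ (hne j)).trans ?_
    by_contra! hlt
    exact hD (Set.mem_iUnion.2 ⟨j, hlt⟩)
  · have d := fun j => Classical.choice
      (nonempty_eigenbasis_empCovOp (H := H) hκ hbound (fun i => (D i).1) (block c j))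
    exact norm_opPow_sub_avgApprox_le hg hm c _ d₀ d hs.1 hr.le hh fun j =>
      d₀.norm_approx_le_of_bound (d j) hr.le hs.1 hg₀

end Main

end DistLearn

end

theorem theorem3p1
    {X : Type*} [MeasurableSpace X] [StandardBorelSpace X]
    {H : Type*} [NormedAddCommGroup H] [InnerProductSpace ℝ H] [CompleteSpace H]
    [TopologicalSpace.SeparableSpace H] [RKHS ℝ H X ℝ]
    (κ : ℝ) (hκ : 0 < κ)
    (hmeas : ∀ f : H, Measurable (fun x : X => f x))
    (hbound : ∀ (f : H) (x : X), |f x| ≤ κ * ‖f‖)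
    (b β r s p q α : ℝ) (hb : 1 < b) (hβ : 0 < β) (hr : 0 < r)
    (hs : s ∈ Set.Icc (0 : ℝ) (1 / 2)) (hp : 1 ≤ p)
    (g : ℝ → ℝ → ℝ) (hg : DistLearn.IsRegularization g)
    (hq : r + s ≤ q) (hgq : DistLearn.HasQualification g q)
    (hα : α < 2 * b * min r 1 / (2 * b * r + b + 1)) :
    (⨆ (σ : ℝ) (_ : 0 < σ) (_M : ℝ) (_ : 0 < _M) (R : ℝ) (_ : 0 < R),
      limsup (fun n : ℕ =>
        ⨆ (m : ℕ) (_ : (m : ℝ) ≤ (n : ℝ) ^ α)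
          (c : Fin n → Fin m) (_ : DistLearn.IsEqualPartition c)
          (ρ : Measure (X × ℝ)) (f : H) (_ : DistLearn.InModel κ b β r σ R ρ f),
          eLpNorm (fun D : Fin n → X × ℝ =>
              DistLearn.opPow (DistLearn.covOp H κ ρ.fst) s
                (f - DistLearn.avgApprox κ g (DistLearn.lamSeq b r σ R n) c
                  (fun i => (D i).1) f))
            (ENNReal.ofReal p) (Measure.pi (fun _ : Fin n => ρ))
          / ENNReal.ofReal (DistLearn.rate b r s σ R n)) atTop) < (⊤ : ENNReal) := by
  obtain ⟨θ, hθ, hbθ, δ, hδ, hx₁, hx₂⟩ := DistLearn.exists_exponents hb hr hα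
  obtain ⟨γ₁, hγ₁⟩ := hg.bound_residual
  obtain ⟨γ, -, hγ⟩ := hgq
  -- At `t = 0` the residual equals 1, which the bound on `(0, 1]` need not cover.
  set γ₀ := max γ₁ 1 with hγ₀
  set e := b / (2 * b * r + b + 1) with he
  have he0 : 0 < e := by have := hb; positivity
  -- The moment order: `n^(-δ k)` must beat `n` blocks times the target probability `(l^(r+s))^p`,
  -- of order `n^(-e (r+s) p)`.
  obtain ⟨k, hk⟩ := exists_nat_gt ((1 + e * (r + s) * p) / δ)
  rw [div_lt_iff₀' hδ] at hk
  obtain ⟨C, hC, hdev⟩ := DistLearn.exists_measure_centTensor_le (X := X) (H := H) k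
  set S := ∑' j : ℕ, (β / ((j : ℝ) + 1) ^ b) ^ θ with hS
  have hS0 : 0 ≤ S := tsum_nonneg fun j => by positivity
  set C₁ := 2 * (2 ^ (r + s) * (|γ₀| + |γ|)) * (2 + ⌊r⌋₊ * 2 ^ max r 1) with hC₁
  have hγ₀0 : 0 ≤ γ₀ := zero_le_one.trans (le_max_right _ _)
  refine lt_of_le_of_lt (b := ENNReal.ofReal (C₁ + γ₀)) ?_ ENNReal.ofReal_lt_top
  refine iSup_le fun σ => iSup_le fun hσ => iSup_le fun _ => iSup_le fun _ => iSup_le fun R =>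
    iSup_le fun hR => ?_
  set c₀ := σ ^ 2 / R ^ 2 with hc₀
  have hc₀0 : 0 < c₀ := by positivity
  have hev := DistLearn.eventually_mul_pow_le (k := k)
    (A₁ := 4 * S * c₀ ^ (-(e * (θ + 2 * max r 1 - 1)))) (A₂ := 16 * c₀ ^ (-(e * (2 * max r 1))))
    (B := c₀ ^ (e * (r + s) * p)) (w := e * (r + s) * p) (by positivity) (by positivity)
    (by positivity) hC hx₁ hx₂ hk
  refine limsup_le_of_le (by isBoundedDefault) ?_
  -- For `n ≥ c₀` the minimum with 1 in the choice of `λ_n` is inactive, and the rate is `R * l ^ (r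
  -- + s)`.
  filter_upwards [hev, eventually_ge_atTop 1, eventually_ge_atTop ⌈c₀⌉₊] with n hn hn1 hnc
  have hn0 : 0 < n := hn1
  have hnr : (0 : ℝ) < n := by exact_mod_cast hn0
  have hcn : σ ^ 2 / (R ^ 2 * n) = c₀ / n := by rw [hc₀, div_div]
  have hcn1 : c₀ / n ≤ 1 := by
    rw [div_le_one hnr]
    exact (Nat.le_ceil _).trans (by exact_mod_cast hnc)
  have hcn0 : 0 < c₀ / n := by positivity
  have hlam : DistLearn.lamSeq b r σ R n = (c₀ / n) ^ e := by
    rw [DistLearn.lamSeq, hcn]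
    exact min_eq_left (Real.rpow_le_one hcn0.le hcn1 he0.le)
  set l := (c₀ / n) ^ e with hl
  have hl0 : 0 < l := by positivity
  have hlmem : l ∈ Set.Ioc (0 : ℝ) 1 := ⟨hl0, Real.rpow_le_one hcn0.le hcn1 he0.le⟩
  have hrate : DistLearn.rate b r s σ R n = R * l ^ (r + s) := by
    rw [DistLearn.rate, hcn, hl, ← Real.rpow_mul hcn0.le, he]
    congr 2
    ring
  rw [hlam, hrate]
  refine iSup_le fun m => iSup_le fun hm => iSup_le fun c => iSup_le fun hc => iSup_le fun ρ =>
    iSup_le fun f => iSup_le fun hρ => ?_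
  refine ENNReal.div_le_of_le_mul ?_
  rw [← ENNReal.ofReal_mul (by positivity)]
  -- With this `ε` the bad event contributes `R * γ₀ * l ^ (r + s)`, the same order as the main
  -- term.
  refine (DistLearn.eLpNorm_approx_le (ε := l ^ (r + s)) (γ₀ := γ₀) hκ hmeas hbound hβ hr
    ⟨hs.1, by linarith [hs.2]⟩ hp hlmem (hg.bddUnit hlmem) hq ?_ (hγ l hlmem) hθ hbθ hC
    (@fun A ρ _ L V η hL hV hη hAV n I hI => hdev hκ hmeas hbound hL hV hη hAV hI) hn0 hc (by positivity)
    (fun N hN hmN => DistLearn.deviation_bound_le (α := α) hS0 hc₀0 hnr hl hN ?_) ?_ hR hρ).trans ?_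
  · intro t ht
    rcases ht.1.eq_or_lt with rfl | h0
    · simp [hγ₀]
    · exact (hγ₁ l hlmem t ⟨h0, ht.2⟩).trans (le_max_left _ _)
  · have : N⁻¹ = m / n := by
      rw [← hmN]
      have hm0 : (m : ℝ) ≠ 0 := by
        rintro h0
        rw [h0, zero_mul] at hmN
        exact hnr.ne hmN
      field_simp
    rw [this, Real.rpow_sub_one hnr.ne']
    gcongr
  · refine hn.trans (le_of_eq ?_)
    rw [hl, ← Real.rpow_mul hcn0.le, ← Real.rpow_mul hcn0.le, Real.div_rpow hc₀0.le hnr.le,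
      Real.rpow_neg hnr.le, div_eq_mul_inv]
  · refine ENNReal.ofReal_le_ofReal (le_of_eq ?_)
    ring
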